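/- **Theorem 2 (Hole-free).** *Setting.* Cells of the hexagonal tiling are given axial coordinates $(p,q)\in\mathcal H=\mathbb Z^2$ ($p$ = column, $q$ = row). The six walls $w=0,\dots,5$ (F, FL, RL, R, RR, FR, counter-clockwise, indices mod 6) have unit vectors $\hat u_0=(0,1)$, $\hat u_1=(-1,1)$, $\hat u_2=(-1,0)$, $\hat u_3=(0,-1)$, $\hat u_4=(1,-1)$, $\hat u_5=(1,0)$; two cells are adjacent if they differ by some $\hat u_w$. Walls $0,3$ are fore-aft, $\{1,2\}$ is the left flank and $\{4,5\}$ the right flank. A simple cycle of adjacent cells *encloses* a cell $y$ not on it if the centre of $y$ lies in the interior of the closed polygon through the centres of the cycle's cells. Let $S\subset\mathcal H$ be a finite set with $(0,0)\in S$ that is *hole-free*: no simple cycle of cells of $S$ encloses a cell outside $S$. Let $X_b$ be the perimeter of $S$, i.e. the cells of $S$ with at least one neighbour outside $S$. Robots know only $X_b$; they call a cell a *target* cell if it is in $X_b$ or enclosed by a simple cycle contained in $X_b$. A *segment* is a maximal contiguous set of target cells in one column; its midpoint is rounded down. *Wall statuses.* When $X(t)$ is the set of occupied cells, wall $w$ of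 a robot at $x$ has status $s_w$ = null if $x+\hat u_w$ is not a target cell, and otherwise occupied or free according to whether $x+\hat u_w\in X(t)$. *Initialization (once, on docking at $x=(p,q)$).* For each flank, with column direction $a=-1$ (left) or $a=1$ (right), the robot sets a nucleation flag $\alpha$: (i) if the flank has no free wall, $\alpha$ is false; (ii) if some free wall of the flank has two null adjacent walls, $\alpha$ is true; (iii) otherwise let $Q'$ be the segment of column $p+a$ that the flank faces, $q_m$ the row of its midpoint, and $Q$ the segment of $x$: $\alpha$ is true if $q=q_m$; false if $q\neq q_m$ and $(p,q_m)\in Q$; and otherwise $\alpha$ is true iff $q=q^\star$, where $q^\star$ is the row nearest to $q_m$ with $(p+a,q^\star)\in Q'$ and $(p,q^\star)\in Q$. The growth direction is $g=0$ if both flags are true; else $g=1$ if $s_1$ or $s_2$ is occupied or $\alpha_{\rm right}$ is true; else $g=-1$ if $s_4$ or $s_5$ is occupied or $\alpha_{\rm left}$ is true; else $g=0$. The flags and $g$ are then fixed. *Signals (at every time step).* If wall 0 or wall 3 is free, the nominal walls are the free fore-aft walls. Otherwise they are the free flank walls that lie between two occupied walls, or between a null fore-aft wall and an occupied wall, or belong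 to a flank whose flag $\alpha$ is true. Delayed walls: if $g=-1$, wall 0 when wall 5 is occupied by a robot whose wall 0 is free, and wall 3 when wall 4 is occupied by a robot whose wall 3 is free; if $g=1$, the same with walls 1 and 2 in place of 5 and 4. The robot signals on its nominal walls that are not delayed. *Execution.* At $t=0$ only the root robot is present, at $(0,0)$, initialized there. In each step an arbitrary (possibly empty) set of robots dock, each at a cell towards which a robot already in the assembly signals; a docking robot initializes itself with the occupancy it finds, which includes all robots present before the step and possibly some of those docking in the same step. Robots never leave. $G(t)$ is the graph on the occupied cells $X(t)$ in which adjacent occupied cells are joined. *Claim.* In every execution and at every time $t$, $G(t)$ is hole-free: no simple cycle in $G(t)$ encloses a cell of $S\setminus X(t)$. -/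

import Mathlib

namespace Huddle

/-! ### The hexagonal lattice, assembly graphs and enclosed positions -/

/-- Axial coordinates `(p, q)` of hexagonal cells: `p` is the column, `q` the row. -/
abbrev Hex : Type := ℤ × ℤ

/-- The six walls of a robot, counter-clockwise:
`0 = F`, `1 = FL`, `2 = RL`, `3 = R`, `4 = RR`, `5 = FR`. Indices are taken modulo 6. -/
abbrev Wall : Type := Fin 6

/-- The unit vector of a wall. -/
def dir : Wall → Hex := ![(0, 1), (-1, 1), (-1, 0), (0, -1), (1, -1), (1, 0)]

theorem dir_add_three (w : Wall) : dir (w + 3) = -dir w := by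
  fin_cases w <;> rfl

theorem dir_ne_zero (w : Wall) : dir w ≠ 0 := by
  fin_cases w <;> decide

/-- The graph of a set `X` of occupied positions: two occupied positions are joined when they
share a wall. (Positions outside `X` are isolated.) -/
def assemblyGraph (X : Set Hex) : SimpleGraph Hex where
  Adj x y := x ∈ X ∧ y ∈ X ∧ ∃ w, y = x + dir w
  symm := ⟨by
    rintro x y ⟨hx, hy, w, rfl⟩
    exact ⟨hy, hx, w + 3, by rw [dir_add_three]; abel⟩⟩
  loopless := ⟨by
    rintro x ⟨-, -, w, h⟩
    exact dir_ne_zero w (by simpa using h)⟩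

/-- The straight edge from `a` to `b` leads from the column of `y` to the next column on the
right, and starts ahead of `y`. Equivalently, it meets the ray that leaves the centre of `y`
in the forward direction, tilted to the right by an infinitesimal angle. -/
def crossesRay (y a b : Hex) : Prop := a.1 = y.1 ∧ b.1 = y.1 + 1 ∧ y.2 < a.2

instance (y a b : Hex) : Decidable (crossesRay y a b) := by
  unfold crossesRay; infer_instance

/-- The position `y` lies in the interior of the closed polygon traced by `c` (through cell
centres): `y` is not on `c`, and a generic ray from `y` to infinity crosses the edges of `c` an odd
number of times (ray casting, i.e. the even-odd rule). -/
def Encloses {G : SimpleGraph Hex} {v : Hex} (c : G.Walk v v) (y : Hex) : Prop :=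
  y ∉ c.support ∧
    Odd (c.darts.countP fun d => decide (crossesRay y d.fst d.snd ∨ crossesRay y d.snd d.fst))

/-- A shape is hole-free: no simple cycle of cells of `S` encloses a position outside `S`. -/
def HoleFreeShape (S : Set Hex) : Prop :=
  ∀ (v : Hex) (c : (assemblyGraph S).Walk v v), c.IsCycle → ∀ y, Encloses c y → y ∈ S

/-- An assembly that occupies the positions `X` is hole-free with respect to the target
shape `S`: no simple cycle of the assembly graph encloses an unoccupied position of `S`. -/
def HoleFreeAssembly (S X : Set Hex) : Prop :=
  ∀ (v : Hex) (c : (assemblyGraph X).Walk v v), c.IsCycle → ∀ y ∈ S \ X, ¬ Encloses c y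

/-- The perimeter of a shape: its cells with at least one unattached side. -/
def perimeter (S : Set Hex) : Set Hex := {x | x ∈ S ∧ ∃ w, x + dir w ∉ S}

/-! ### The robots

All rules below see the target shape only through its perimeter `Xb`. -/

/-- The positions a robot takes to be target positions: those in `Xb` or enclosed by a simple
cycle contained in `Xb`. -/
def target (Xb : Set Hex) : Set Hex :=
  {y | y ∈ Xb ∨ ∃ (v : Hex) (c : (assemblyGraph Xb).Walk v v), c.IsCycle ∧ Encloses c y}

inductive Status
  | null
  | free
  | occupied
  deriving DecidableEq

inductive Flank
  | left
  | right

/-- The two walls of a flank. -/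
def Flank.walls : Flank → Set Wall
  | .left => {1, 2}
  | .right => {4, 5}

/-- The column direction of a flank. -/
def Flank.column : Flank → ℤ
  | .left => -1
  | .right => 1

/-- The front and the rear wall. -/
def foreAft : Set Wall := {0, 3}

open Classical in
/-- The wall status vector of a robot at `x` when the positions `X` are occupied. A wall is a
connection wall when it faces a target position, and a null wall otherwise. -/
noncomputable def status (Xb X : Set Hex) (x : Hex) (w : Wall) : Status :=
  if x + dir w ∈ target Xb then (if x + dir w ∈ X then .occupied else .free) else .null

open Classical in
/-- Nucleation requirement of a flank from the robot's own wall status vector `s`;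
`none` stands for "undefined". -/
noncomputable def roleFromSelf (s : Wall → Status) (f : Flank) : Option Bool :=
  if ∃ w ∈ f.walls, s w = .free then
    if ∃ w ∈ f.walls, s w = .free ∧ s (w + 1) = .null ∧ s (w - 1) = .null then some true
    else none
  else some false

/-- Rows of the contiguous column segment of target positions that contains `x`
(empty when `x` is not a target position). -/
def segmentRows (Xb : Set Hex) (x : Hex) : Set ℤ :=
  {r | ∀ k ∈ Set.uIcc x.2 r, (x.1, k) ∈ target Xb}

/-- Rows of the target segment in the adjacent column that a flank of a robot at `x` faces.
(The two positions faced by a flank are neighbours in one column, so if both are target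
positions, they lie in the same segment.) -/
def facingRows (Xb : Set Hex) (x : Hex) (f : Flank) : Set ℤ :=
  {r | ∃ w ∈ f.walls, x + dir w ∈ target Xb ∧ r ∈ segmentRows Xb (x + dir w)}

/-- Row of the midpoint, rounded down, of a segment with rows `Q`. -/
noncomputable def midRow (Q : Set ℤ) : ℤ := (sInf Q + sSup Q) / 2

open Classical in
/-- Nucleation requirement of a flank from the target segments of the adjacent column. In the
last case, `q` is required to be the row of the point nearest to the midpoint, among the points of
the adjacent segment that have a neighbour on their own row in the robot's segment. -/
noncomputable def roleFromColumn (Xb : Set Hex) (x : Hex) (f : Flank) : Bool :=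
  if ∀ q, (x.1 + f.column, q) ∉ target Xb then false
  else
    let m := midRow (facingRows Xb x f)
    if x.2 = m then true
    else if m ∈ segmentRows Xb x then false
    else
      let R := facingRows Xb x f ∩ segmentRows Xb x
      decide (x.2 ∈ R ∧ ∀ r ∈ R, |x.2 - m| ≤ |r - m|)

/-- The nucleation requirement of a flank. -/
noncomputable def nucleates (Xb X : Set Hex) (x : Hex) (f : Flank) : Bool :=
  (roleFromSelf (status Xb X x) f).getD (roleFromColumn Xb x f)

/-- The growth direction: `1` right, `-1` left, `0` neutral. -/
def growthDirection (s : Wall → Status) (αl αr : Bool) : ℤ :=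
  if αl = true ∧ αr = true then 0
  else if (s 1 = .occupied ∨ s 2 = .occupied) ∨ αr = true then 1
  else if (s 4 = .occupied ∨ s 5 = .occupied) ∨ αl = true then -1
  else 0

/-- What a robot fixes once and for all when it docks: the nucleation requirements of its flanks
and its growth direction. -/
structure Memory where
  nucLeft : Bool
  nucRight : Bool
  growth : ℤ

/-- The initialization phase of a robot docking at `x` that finds the positions `X` occupied. -/
noncomputable def initMemory (Xb X : Set Hex) (x : Hex) : Memory where
  nucLeft := nucleates Xb X x .left
  nucRight := nucleates Xb X x .right
  growth := growthDirection (status Xb X x) (nucleates Xb X x .left) (nucleates Xb X x .right)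

open Classical in
/-- The walls that nominally require a signal. Fore-aft walls have priority. A free flank wall
signals if it is between two occupied walls, or between a null fore-aft wall and an occupied wall,
or if its flank has to be nucleated. -/
noncomputable def nominalWalls (s : Wall → Status) (m : Memory) : Set Wall :=
  if s 0 = .free ∨ s 3 = .free then {w | w ∈ foreAft ∧ s w = .free}
  else
    {w | w ∉ foreAft ∧ s w = .free ∧
      ((s (w + 1) = .occupied ∧ s (w - 1) = .occupied) ∨
        (w + 1 ∈ foreAft ∧ s (w + 1) = .null ∧ s (w - 1) = .occupied) ∨
        (w - 1 ∈ foreAft ∧ s (w - 1) = .null ∧ s (w + 1) = .occupied))} ∪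
    {w | m.nucLeft = true ∧ w ∈ Flank.left.walls ∧ s w = .free} ∪
    {w | m.nucRight = true ∧ w ∈ Flank.right.walls ∧ s w = .free}

/-- The walls whose signal is delayed; `n w` is the wall status vector of the neighbour at
wall `w` (only used when that wall is occupied). -/
def delayedWalls (s : Wall → Status) (n : Wall → Wall → Status) (g : ℤ) : Set Wall :=
  {w | (g = -1 ∧ ((w = 0 ∧ s 5 = .occupied ∧ n 5 0 = .free) ∨
                  (w = 3 ∧ s 4 = .occupied ∧ n 4 3 = .free))) ∨
       (g = 1 ∧ ((w = 0 ∧ s 1 = .occupied ∧ n 1 0 = .free) ∨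
                 (w = 3 ∧ s 2 = .occupied ∧ n 2 3 = .free)))}

/-- The walls on which a robot at `x` with memory `m` signals when the positions `X` are
occupied. -/
noncomputable def signals (Xb X : Set Hex) (x : Hex) (m : Memory) : Set Wall :=
  nominalWalls (status Xb X x) m \
    delayedWalls (status Xb X x) (fun w => status Xb X (x + dir w)) m.growth

/-! ### Executions -/

/-- A state of the assembly: which positions hold a robot, and the memory of that robot. -/
abbrev State : Type := Hex → Option Memory

/-- The occupied positions. -/
def occupied (σ : State) : Set Hex := {x | ∃ m, σ x = some m}

/-- The initial state: only the root robot, at the origin. -/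
def IsInitial (Xb : Set Hex) (σ : State) : Prop :=
  σ (0, 0) = some (initMemory Xb {(0, 0)} (0, 0)) ∧ ∀ x, x ≠ (0, 0) → σ x = none

/-- One time step. Robots in the assembly stay with their memory unchanged. Any set of passing-by
robots (possibly empty, possibly several at once) dock, each at an opening towards which some robot
of the assembly signals. A docking robot initializes itself with the occupancy `V` that it
finds: every robot of the previous state, and an arbitrary part of those that dock in this step. -/
def Step (Xb : Set Hex) (σ τ : State) : Prop :=
  (∀ x m, σ x = some m → τ x = some m) ∧
  ∀ y m, σ y = none → τ y = some m →
    (∃ x mx w, σ x = some mx ∧ w ∈ signals Xb (occupied σ) x mx ∧ y = x + dir w) ∧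
    ∃ V, occupied σ ⊆ V ∧ V ⊆ occupied τ ∧ m = initMemory Xb V y

/-- A sequence of states produced by robots that follow the rules with perimeter `Xb`. -/
def IsExecution (Xb : Set Hex) (σ : ℕ → State) : Prop :=
  IsInitial Xb (σ 0) ∧ ∀ t, Step Xb (σ t) (σ (t + 1))

end Huddle

/-! Cut `S` into its column segments. Since `S` is finite and hole-free, adjacency of segments in
neighbouring columns is tree-like: rooted at the segment of the origin, every other segment has at
most one parent (`IsParent.unique`), and of two touching segments one is the parent of the other.

The theorem reduces to contiguity of the occupied part of each segment. If a cycle of robots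
enclosed an empty cell of `S`, the cells just beyond the two ends of its segment would still not be
enclosed, being outside `S`. So the crossing parity changes above and below the empty cell, the
cycle visits the segment on both sides of it, and contiguity is violated
(`holeFreeAssembly_of_contiguous`).

Contiguity is carried by `Invariant`. A segment is entered only from the nucleation site of its
parent, which the two segments determine whatever the occupancy (`NucSite.unique`). Afterwards every
signalled cell has an occupied neighbour in its column (`Invariant.exists_near`). This needs free
flank walls to face child segments only, that is, no robot may dock beside an empty parent cell.
Growth directions point away from the parent, and the delay rule stops a robot from advancing beyond
the front of the parent segment (`Invariant.parent_of_isSignalled`).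

The topology is ray casting modulo two: where no cycle encloses `y`, crossing numbers with a ray
from `y` are the coboundary of a potential. Comparing rays whose crossings agree away from one
segment gives the tree structure (`mem_segment_of_reachable`). Summing over lattice triangles shows
that the perimeter determines `S` (`target_perimeter`). -/

namespace Huddle

open SimpleGraph

/-! ### Edge weights modulo two and potentials -/

section Potential

variable {V : Type*} {G : SimpleGraph V}

/-- The sum of the weights `h` of the edges of a walk. -/
def walkWeight (h : V → V → ZMod 2) {u v : V} (p : G.Walk u v) : ZMod 2 :=
  (p.darts.map fun d => h d.fst d.snd).sum

@[simp] theorem walkWeight_nil (h : V → V → ZMod 2) (u : V) :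
    walkWeight h (Walk.nil : G.Walk u u) = 0 := rfl

@[simp] theorem walkWeight_cons (h : V → V → ZMod 2) {u v w : V} (e : G.Adj u v)
    (p : G.Walk v w) : walkWeight h (Walk.cons e p) = h u v + walkWeight h p := by
  simp [walkWeight]

@[simp] theorem walkWeight_append (h : V → V → ZMod 2) {u v w : V} (p : G.Walk u v)
    (q : G.Walk v w) : walkWeight h (p.append q) = walkWeight h p + walkWeight h q := by
  simp [walkWeight]

/-- Each piece cut out is an edge followed by a path back to its start. This is a cycle, of weight
zero by hypothesis, unless the path is the same edge reversed, whose two equal weights cancel modulo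
two. -/
theorem walkWeight_bypass [DecidableEq V] (h : V → V → ZMod 2) (hsymm : ∀ a b, h a b = h b a)
    (hc : ∀ v (c : G.Walk v v), c.IsCycle → walkWeight h c = 0) {u v : V} (p : G.Walk u v) :
    walkWeight h p.bypass = walkWeight h p := by
  induction p with
  | nil => rfl
  | @cons u v w e p ih =>
    rw [Walk.bypass]
    split_ifs with hs
    · have hpath : (p.bypass.takeUntil u hs).IsPath := (p.bypass_isPath).takeUntil hs
      have hsplit : walkWeight h p.bypass = walkWeight h (p.bypass.takeUntil u hs) +
          walkWeight h (p.bypass.dropUntil u hs) := by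
        rw [← walkWeight_append, Walk.take_spec]
      have key : h u v + walkWeight h (p.bypass.takeUntil u hs) = 0 := by
        by_cases he : s(u, v) ∈ (p.bypass.takeUntil u hs).edges
        · generalize p.bypass.takeUntil u hs = q at hpath he
          cases q with
          | nil => exact absurd rfl e.ne
          | @cons _ x _ e' q =>
            rw [Walk.cons_isPath_iff] at hpath
            rw [Walk.edges_cons, List.mem_cons] at he
            rcases he with he | he
            · have hx : x = u := by
                rcases Sym2.eq_iff.1 he with ⟨h1, -⟩ | ⟨h1, -⟩
                · exact absurd h1 e.ne
                · exact h1.symm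
              subst hx
              have : q = Walk.nil := by
                simpa using hpath.1
              subst this
              rw [walkWeight_cons, walkWeight_nil, hsymm v x, add_zero]
              exact CharTwo.add_self_eq_zero _
            · exact absurd (Walk.snd_mem_support_of_mem_edges _ he) hpath.2
        · have := hc u _ (Path.cons_isCycle ⟨_, hpath⟩ e he)
          simpa using this
      rw [walkWeight_cons, ← ih, hsplit, ← add_assoc, key, zero_add]
    · rw [walkWeight_cons, walkWeight_cons, ih]

theorem walkWeight_closed (h : V → V → ZMod 2) (hsymm : ∀ a b, h a b = h b a)
    (hc : ∀ v (c : G.Walk v v), c.IsCycle → walkWeight h c = 0) {v : V} (c : G.Walk v v) :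
    walkWeight h c = 0 := by
  classical
  rw [← walkWeight_bypass h hsymm hc c]
  rw [(Walk.isPath_iff_nil.1 c.bypass_isPath).eq_nil, walkWeight_nil]

theorem walkWeight_reverse (h : V → V → ZMod 2) (hsymm : ∀ a b, h a b = h b a) {u v : V}
    (p : G.Walk u v) : walkWeight h p.reverse = walkWeight h p := by
  induction p with
  | nil => rfl
  | cons e p ih =>
    rw [Walk.reverse_cons, walkWeight_append, walkWeight_cons, walkWeight_cons, ih,
      walkWeight_nil, hsymm, add_zero, add_comm]

/-- A symmetric weight that vanishes on all cycles is the coboundary of a potential. -/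
theorem exists_potential (h : V → V → ZMod 2) (hsymm : ∀ a b, h a b = h b a)
    (hc : ∀ v (c : G.Walk v v), c.IsCycle → walkWeight h c = 0) :
    ∃ φ : V → ZMod 2, ∀ a b, G.Adj a b → h a b = φ a + φ b := by
  classical
  -- The potential is the weight of a chosen walk from a representative of the component. The
  -- default value 0 plays no role, since it is only evaluated at vertices reachable from the
  -- representative.
  let φ : V → V → ZMod 2 := fun r v => if hr : G.Reachable r v then walkWeight h hr.some else 0
  refine ⟨fun v => φ (G.connectedComponentMk v).out v, fun a b hab => ?_⟩
  have hmk : G.connectedComponentMk b = G.connectedComponentMk a :=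
    ConnectedComponent.eq.2 hab.symm.reachable
  have ha : G.Reachable (G.connectedComponentMk a).out a :=
    ConnectedComponent.eq.1 (Quot.out_eq (G.connectedComponentMk a))
  have hb := ha.trans hab.reachable
  have hz := walkWeight_closed h hsymm hc
    ((ha.some.append (Walk.cons hab Walk.nil)).append hb.some.reverse)
  simp only [walkWeight_append, walkWeight_cons, walkWeight_nil, walkWeight_reverse h hsymm,
    add_zero] at hz
  simp only [hmk, φ, dif_pos ha, dif_pos hb]
  generalize walkWeight h ha.some = s at *
  generalize walkWeight h hb.some = t at *
  generalize h a b = r at *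
  revert r s t
  decide

/-- The weight of a walk is the potential difference of its ends. -/
theorem walkWeight_eq_potential {h : V → V → ZMod 2} {φ : V → ZMod 2}
    (hφ : ∀ a b, G.Adj a b → h a b = φ a + φ b) {u v : V} (p : G.Walk u v) :
    walkWeight h p = φ u + φ v := by
  induction p with
  | nil => exact (CharTwo.add_self_eq_zero _).symm
  | @cons u v w e p ih =>
    rw [walkWeight_cons, ih, hφ _ _ e, add_assoc, ← add_assoc (φ v), CharTwo.add_self_eq_zero,
      zero_add]

end Potential

/-! ### Crossing numbers modulo two -/

/-- The number, modulo two, of crossings of an edge with the ray of `crossesRay`. -/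
def crossing (y a b : Hex) : ZMod 2 := if crossesRay y a b ∨ crossesRay y b a then 1 else 0

theorem crossing_comm (y a b : Hex) : crossing y a b = crossing y b a := by
  unfold crossing; simp only [or_comm]

theorem odd_countP_iff {G : SimpleGraph Hex} {u v : Hex} (c : G.Walk u v) (y : Hex) :
    Odd (c.darts.countP fun d => decide (crossesRay y d.fst d.snd ∨ crossesRay y d.snd d.fst)) ↔
      walkWeight (crossing y) c = 1 := by
  rw [← ZMod.natCast_eq_one_iff_odd, walkWeight]
  suffices ∀ l : List G.Dart, ((l.countP fun d =>
      decide (crossesRay y d.fst d.snd ∨ crossesRay y d.snd d.fst) : ℕ) : ZMod 2) =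
      (l.map fun d => crossing y d.fst d.snd).sum by rw [this]
  intro l
  induction l with
  | nil => simp
  | cons d l ih =>
    rw [List.countP_cons, List.map_cons, List.sum_cons, Nat.cast_add, ih, add_comm, crossing]
    congr 1
    simp

theorem zmod_two_ne_one {a : ZMod 2} : a ≠ 1 ↔ a = 0 := by
  revert a; decide

theorem crossing_eq_zero_of_fst_eq {y a b : Hex} (h : a.1 = b.1) : crossing y a b = 0 := by
  unfold crossing crossesRay
  rw [if_neg]
  omega

theorem mem_of_mem_support {X : Set Hex} {u v w : Hex} (p : (assemblyGraph X).Walk u v)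
    (hu : u ∈ X) (hw : w ∈ p.support) : w ∈ X := by
  induction p with
  | nil => rw [Walk.support_nil, List.mem_singleton] at hw; exact hw ▸ hu
  | cons e p ih =>
    rw [Walk.support_cons, List.mem_cons] at hw
    rcases hw with rfl | hw
    · exact hu
    · exact ih e.2.1 hw

/-- The cycles in `X` that do not pass through `y` have a crossing potential unless one of them
encloses `y`. -/
theorem exists_crossing_potential {X : Set Hex} {y : Hex} (hy : y ∉ X)
    (hX : ∀ (v : Hex) (c : (assemblyGraph X).Walk v v), c.IsCycle → ¬ Encloses c y) :
    ∃ φ : Hex → ZMod 2, ∀ a b, (assemblyGraph X).Adj a b → crossing y a b = φ a + φ b := by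
  refine exists_potential _ (crossing_comm y) fun v c hc => ?_
  by_contra hne
  refine hX v c hc ⟨fun hmem => hy ?_, (odd_countP_iff c y).2 ?_⟩
  · have hv : v ∈ X := by
      cases c with
      | nil => exact absurd rfl hc.ne_nil
      | cons e p => exact e.1
    exact mem_of_mem_support c hv hmem
  · by_contra h; exact hne (zmod_two_ne_one.1 h)

/-! ### Adjacency in coordinates, and the target of a perimeter -/

theorem exists_dir_iff {x y : Hex} : (∃ w, y = x + dir w) ↔
    (y.1 = x.1 ∧ (y.2 = x.2 + 1 ∨ y.2 = x.2 - 1)) ∨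
    (y.1 = x.1 - 1 ∧ (y.2 = x.2 + 1 ∨ y.2 = x.2)) ∨
    (y.1 = x.1 + 1 ∧ (y.2 = x.2 - 1 ∨ y.2 = x.2)) := by
  obtain ⟨p, q⟩ := x
  obtain ⟨p', q'⟩ := y
  simp only [Fin.exists_fin_succ, IsEmpty.exists_iff, dir, Prod.ext_iff, Prod.fst_add,
    Prod.snd_add]
  simp
  omega

theorem adj_iff {X : Set Hex} {x y : Hex} : (assemblyGraph X).Adj x y ↔ x ∈ X ∧ y ∈ X ∧
    ((y.1 = x.1 ∧ (y.2 = x.2 + 1 ∨ y.2 = x.2 - 1)) ∨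
    (y.1 = x.1 - 1 ∧ (y.2 = x.2 + 1 ∨ y.2 = x.2)) ∨
    (y.1 = x.1 + 1 ∧ (y.2 = x.2 - 1 ∨ y.2 = x.2))) := by
  rw [← exists_dir_iff]; rfl

theorem assemblyGraph_mono {X Y : Set Hex} (h : X ⊆ Y) : assemblyGraph X ≤ assemblyGraph Y :=
  fun _ _ hab => ⟨h hab.1, h hab.2.1, hab.2.2⟩

theorem perimeter_subset (S : Set Hex) : perimeter S ⊆ S := fun _ hx => hx.1

theorem target_perimeter_subset {S : Set Hex} (hS : HoleFreeShape S) :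
    target (perimeter S) ⊆ S := by
  rintro y (hy | ⟨v, c, hc, hy⟩)
  · exact hy.1
  · have hle := assemblyGraph_mono (perimeter_subset S)
    refine hS v (c.mapLe hle) (hc.mapLe hle) y ⟨by simpa using hy.1, ?_⟩
    have h1 := hy.2
    rw [odd_countP_iff] at h1 ⊢
    rw [← h1]
    simp [walkWeight, Function.comp_def]

theorem crossing_of_fst_eq_add_one {y a b : Hex} (h : b.1 = a.1 + 1) :
    crossing y a b = if a.1 = y.1 ∧ y.2 < a.2 then 1 else 0 := by
  unfold crossing crossesRay
  exact if_congr (by omega) rfl rfl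

/-- The discrete Stokes formula: a ray meets the boundary of a triangle an odd number of times only
if it starts there. Tilted to the right, the ray from `y` starts into the triangle on `y`, `y + (0,
1)`, `y + (1, 0)`. Triangles of the other orientation contribute nothing, by
`crossing_triangle_right`. -/
theorem crossing_triangle_left (y k : Hex) :
    crossing y k (k + (0, 1)) + crossing y k (k + (1, 0)) + crossing y (k + (0, 1)) (k + (1, 0)) =
      if k = y then 1 else 0 := by
  rw [crossing_eq_zero_of_fst_eq (by simp), crossing_of_fst_eq_add_one (by simp),
    crossing_of_fst_eq_add_one (by simp)]
  simp only [Prod.ext_iff, Prod.fst_add, Prod.snd_add]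
  by_cases h1 : k.1 = y.1 ∧ y.2 < k.2
  · rw [if_pos h1, if_pos (by omega), if_neg (by omega)]; decide
  · by_cases h2 : k.1 = y.1 ∧ k.2 = y.2
    · rw [if_neg h1, if_pos (by omega), if_pos h2]; decide
    · rw [if_neg h1, if_neg (by omega), if_neg h2]; decide

theorem crossing_triangle_right (y k : Hex) :
    crossing y (k + (1, -1)) (k + (1, 0)) + crossing y k (k + (1, 0)) +
      crossing y k (k + (1, -1)) = 0 := by
  rw [crossing_eq_zero_of_fst_eq (by simp), crossing_of_fst_eq_add_one (by simp),
    crossing_of_fst_eq_add_one (by simp), zero_add]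
  exact CharTwo.add_self_eq_zero _

/-- Each interior cell of a finite shape is enclosed by a cycle in the perimeter: otherwise there
is a crossing potential on the perimeter, and summing its defect over the triangles that touch
the interior gives a contradiction. -/
theorem subset_target_perimeter {S : Set Hex} (hfin : S.Finite) : S ⊆ target (perimeter S) := by
  classical
  intro y hyS
  by_contra hy
  have hyX : y ∉ perimeter S := fun h => hy (Or.inl h)
  obtain ⟨φ, hφ⟩ := exists_crossing_potential hyX fun v c hc he => hy (Or.inr ⟨v, c, hc, he⟩)
  set K : Set Hex := S \ perimeter S with hK
  have hKfin : K.Finite := hfin.subset Set.sdiff_subset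
  -- The defect of the potential: it vanishes on edges of the perimeter, but `φ` is uncontrolled at
  -- the interior cells `K`. The factor `β` selects the triangles that touch `K`.
  let g : Hex → Hex → ZMod 2 := fun a b => crossing y a b + φ a + φ b
  let β : Hex → Hex → Hex → ZMod 2 := fun a b c => if a ∈ K ∨ b ∈ K ∨ c ∈ K then 1 else 0
  have hnb : ∀ c a, c ∈ K → (∃ w, a = c + dir w) → a ∈ S := by
    rintro c _ hc ⟨w, rfl⟩
    by_contra h
    exact hc.2 ⟨hc.1, w, h⟩
  have hg : ∀ a b c, (∃ w, b = a + dir w) → (∃ w, a = c + dir w) → (∃ w, b = c + dir w) →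
      c ∈ K → a ∉ K → b ∉ K → g a b = 0 := by
    intro a b c hab hca hcb hc ha hb
    have ha' : a ∈ perimeter S := by_contra fun h => ha ⟨hnb c a hc hca, h⟩
    have hb' : b ∈ perimeter S := by_contra fun h => hb ⟨hnb c b hc hcb, h⟩
    simp only [g]
    rw [hφ a b ⟨ha', hb', hab⟩, add_assoc]
    exact CharTwo.add_self_eq_zero _
  -- An edge lies in two triangles. If just one of them touches `K`, both ends of the edge are in
  -- the perimeter and the defect is zero; so the edge contributes equally to both triangles.
  have hβ : ∀ a b c d, (∃ w, b = a + dir w) → (∃ w, a = c + dir w) → (∃ w, b = c + dir w) →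
      (∃ w, a = d + dir w) → (∃ w, b = d + dir w) → β a b c * g a b = β a b d * g a b := by
    intro a b c d hab hca hcb hda hdb
    by_cases ha : a ∈ K
    · simp [β, ha]
    by_cases hb : b ∈ K
    · simp [β, hb]
    by_cases hc : c ∈ K
    · rw [hg a b c hab hca hcb hc ha hb]; simp
    by_cases hd : d ∈ K
    · rw [hg a b d hab hda hdb hd ha hb]; simp
    simp [β, ha, hb, hc, hd]
  let U : Hex → ZMod 2 := fun k => β k (k + (0, 1)) (k + (1, 0))
  let D : Hex → ZMod 2 := fun k => β k (k + (1, -1)) (k + (1, 0))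
  have hfinβ : ∀ u v : Hex, {k | β k (k + u) (k + v) ≠ 0}.Finite := by
    intro u v
    refine ((hKfin.union (hKfin.image fun k => k - u)).union
      (hKfin.image fun k => k - v)).subset ?_
    intro k hk
    have : k ∈ K ∨ k + u ∈ K ∨ k + v ∈ K := by
      by_contra h
      exact hk (if_neg h)
    rcases this with h | h | h
    · exact Or.inl (Or.inl h)
    · exact Or.inl (Or.inr ⟨_, h, by simp⟩)
    · exact Or.inr ⟨_, h, by simp⟩
  have hfinU : ∀ f : Hex → ZMod 2, Function.HasFiniteSupport fun k => U k * f k := fun f =>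
    (hfinβ _ _).subset fun k hk => left_ne_zero_of_mul hk
  have hfinD : ∀ f : Hex → ZMod 2, Function.HasFiniteSupport fun k => D k * f k := fun f =>
    (hfinβ _ _).subset fun k hk => left_ne_zero_of_mul hk
  have hrot : ∀ a b c, β a b c = β b c a := fun a b c => if_congr (by tauto) rfl rfl
  have hswap : ∀ a b c, β a b c = β a c b := fun a b c => if_congr (by tauto) rfl rfl
  have h2 : (2 : ZMod 2) = 0 := rfl
  -- Each edge borders one triangle of each orientation. The translations in `e1` and `e3` match the
  -- two; in `e2` no translation is needed.
  have e1 : ∑ᶠ k, U k * g k (k + (0, 1)) = ∑ᶠ k, D k * g (k + (1, -1)) (k + (1, 0)) := by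
    rw [← finsum_comp_equiv (Equiv.addRight ((-1, 1) : Hex)) (f := fun k => D k * g _ _)]
    refine finsum_congr fun k => ?_
    have h1 : k + (-1, 1) + (1, -1) = k := by ext <;> simp
    have h2 : k + (-1, 1) + (1, 0) = k + (0, 1) := by ext <;> simp
    simp only [U, D, Equiv.coe_addRight, h1, h2]
    rw [hrot (k + (-1, 1))]
    apply hβ <;> rw [exists_dir_iff] <;> simp
  have e2 : ∑ᶠ k, U k * g k (k + (1, 0)) = ∑ᶠ k, D k * g k (k + (1, 0)) := by
    refine finsum_congr fun k => ?_
    simp only [U, D]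
    rw [hswap k, hswap k (k + (1, -1))]
    apply hβ <;> rw [exists_dir_iff] <;> simp
  have e3 : ∑ᶠ k, U k * g (k + (0, 1)) (k + (1, 0)) = ∑ᶠ k, D k * g k (k + (1, -1)) := by
    rw [← finsum_comp_equiv (Equiv.addRight ((0, 1) : Hex)) (f := fun k => D k * g _ _)]
    refine finsum_congr fun k => ?_
    have h1 : k + (0, 1) + (1, -1) = k + (1, 0) := by ext <;> simp
    simp only [U, D, Equiv.coe_addRight, h1]
    rw [hrot k]
    apply hβ <;> rw [exists_dir_iff] <;> simp
  have hUsum : ∑ᶠ k, U k * (g k (k + (0, 1)) + g k (k + (1, 0)) +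
      g (k + (0, 1)) (k + (1, 0))) = 1 := by
    -- Around a triangle each value of `φ` occurs twice, so only the crossings remain.
    have hval : ∀ k, g k (k + (0, 1)) + g k (k + (1, 0)) + g (k + (0, 1)) (k + (1, 0)) =
        if k = y then 1 else 0 := fun k => by
      rw [← crossing_triangle_left]
      linear_combination (φ k + φ (k + (0, 1)) + φ (k + (1, 0))) * h2
    simp only [hval]
    rw [finsum_eq_single _ y fun k hk => by rw [if_neg hk, mul_zero]]
    have hyK : y ∈ K := ⟨hyS, hyX⟩
    simp [U, β, hyK]
  have hDsum : ∑ᶠ k, D k * (g (k + (1, -1)) (k + (1, 0)) + g k (k + (1, 0)) +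
      g k (k + (1, -1))) = 0 := by
    have hval : ∀ k, g (k + (1, -1)) (k + (1, 0)) + g k (k + (1, 0)) + g k (k + (1, -1)) =
        0 := fun k => by
      rw [← crossing_triangle_right y k]
      linear_combination (φ k + φ (k + (1, -1)) + φ (k + (1, 0))) * h2
    simp only [hval, mul_zero, finsum_zero]
  simp only [mul_add] at hUsum hDsum
  rw [finsum_add_distrib (by simpa only [mul_add] using hfinU (fun k => _ + _)) (hfinU _),
    finsum_add_distrib (hfinU _) (hfinU _)] at hUsum
  rw [finsum_add_distrib (by simpa only [mul_add] using hfinD (fun k => _ + _)) (hfinD _),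
    finsum_add_distrib (hfinD _) (hfinD _)] at hDsum
  rw [e1, e2, e3, hDsum] at hUsum
  exact zero_ne_one hUsum

theorem target_perimeter {S : Set Hex} (hfin : S.Finite) (hS : HoleFreeShape S) :
    target (perimeter S) = S :=
  (target_perimeter_subset hS).antisymm (subset_target_perimeter hfin)

/-! ### Column segments -/

/-- The column segment of `S` through `x`. -/
def segment (S : Set Hex) (x : Hex) : Set Hex :=
  {y | y.1 = x.1 ∧ ∀ k, min x.2 y.2 ≤ k → k ≤ max x.2 y.2 → (x.1, k) ∈ S}

section Segment

variable {S : Set Hex} {x y z : Hex}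

theorem mem_segment_self (hx : x ∈ S) : x ∈ segment S x := by
  refine ⟨rfl, fun k h1 h2 => ?_⟩
  have : k = x.2 := by omega
  subst this; exact hx

theorem segment_subset : segment S x ⊆ S := by
  rintro ⟨p, q⟩ ⟨h1, h2⟩
  have : p = x.1 := h1
  subst this
  exact h2 q (by simp) (by simp)

theorem mem_segment_comm (h : y ∈ segment S x) : x ∈ segment S y :=
  ⟨h.1.symm, fun k h1 h2 => by rw [h.1]; exact h.2 k (by omega) (by omega)⟩

theorem mem_segment_trans (hxy : y ∈ segment S x) (hyz : z ∈ segment S y) : z ∈ segment S x := by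
  refine ⟨hyz.1.trans hxy.1, fun k h1 h2 => ?_⟩
  by_cases h : min x.2 y.2 ≤ k ∧ k ≤ max x.2 y.2
  · exact hxy.2 k h.1 h.2
  · have := hyz.2 k (by omega) (by omega)
    rwa [hxy.1] at this

theorem segment_eq (h : y ∈ segment S x) : segment S y = segment S x :=
  Set.ext fun _ => ⟨mem_segment_trans h, mem_segment_trans (mem_segment_comm h)⟩

/-- Cells of a column at distance at most one belong to the same segment. -/
theorem mem_segment_of_near (hx : x ∈ S) (hy : y ∈ S) (h : y.1 = x.1)
    (h1 : y.2 ≤ x.2 + 1) (h2 : x.2 ≤ y.2 + 1) : y ∈ segment S x := by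
  refine ⟨h, fun k h3 h4 => ?_⟩
  have : k = x.2 ∨ k = y.2 := by omega
  rcases this with rfl | rfl
  · exact hx
  · rw [← h]; exact hy

theorem exists_above_notMem (hfin : S.Finite) (x : Hex) : ∃ k, x.2 < k ∧ (x.1, k) ∉ S := by
  by_contra! h
  exact (Set.Ioi_infinite x.2).image (f := fun k => (x.1, k)) (fun a _ b _ hab => by simpa using hab)
    (hfin.subset (by rintro _ ⟨k, hk, rfl⟩; exact h k hk))

theorem exists_below_notMem (hfin : S.Finite) (x : Hex) : ∃ k, k < x.2 ∧ (x.1, k) ∉ S := by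
  by_contra! h
  exact (Set.Iio_infinite x.2).image (f := fun k => (x.1, k)) (fun a _ b _ hab => by simpa using hab)
    (hfin.subset (by rintro _ ⟨k, hk, rfl⟩; exact h k hk))

/-- A segment of a finite shape has a bottom row `l` and a top row `u`. -/
theorem exists_segment_bounds (hfin : S.Finite) (hx : x ∈ S) :
    ∃ l u, (x.1, l - 1) ∉ S ∧ (x.1, u + 1) ∉ S ∧
      ∀ y, y ∈ segment S x ↔ y.1 = x.1 ∧ l ≤ y.2 ∧ y.2 ≤ u := by
  obtain ⟨u, ⟨hu1, hu2⟩, hu⟩ := Int.exists_least_of_bdd (P := fun k => x.2 < k ∧ (x.1, k) ∉ S)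
    ⟨x.2, fun k hk => hk.1.le⟩ (exists_above_notMem hfin x)
  obtain ⟨l, ⟨hl1, hl2⟩, hl⟩ := Int.exists_greatest_of_bdd
    (P := fun k => k < x.2 ∧ (x.1, k) ∉ S) ⟨x.2, fun k hk => hk.1.le⟩ (exists_below_notMem hfin x)
  refine ⟨l + 1, u - 1, by simpa using hl2, by simpa using hu2, fun y => ⟨fun hy => ?_, ?_⟩⟩
  · refine ⟨hy.1, ?_, ?_⟩
    · by_contra h
      exact hl2 (hy.2 l (by omega) (by omega))
    · by_contra h
      exact hu2 (hy.2 u (by omega) (by omega))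
  · rintro ⟨h1, h2, h3⟩
    refine ⟨h1, fun k h4 h5 => ?_⟩
    by_contra hk
    rcases lt_trichotomy k x.2 with h | rfl | h
    · have := hl k ⟨h, hk⟩; omega
    · exact hk hx
    · have := hu k ⟨h, hk⟩; omega

theorem lt_or_lt_of_notMem_segment {l u : ℤ} (hl : (x.1, l - 1) ∉ S) (hu : (x.1, u + 1) ∉ S)
    (hseg : ∀ y, y ∈ segment S x ↔ y.1 = x.1 ∧ l ≤ y.2 ∧ y.2 ≤ u) (hy : y ∈ S)
    (hyx : y ∉ segment S x) (h : y.1 = x.1) : y.2 < l - 1 ∨ u + 1 < y.2 := by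
  rw [hseg] at hyx
  have h1 : y.2 ≠ l - 1 := fun h' => hl (by rwa [← h, ← h'])
  have h2 : y.2 ≠ u + 1 := fun h' => hu (by rwa [← h, ← h'])
  omega

theorem exists_notMem_between (h : y.1 = x.1) (hy : y ∉ segment S x) :
    ∃ k, min x.2 y.2 ≤ k ∧ k ≤ max x.2 y.2 ∧ (x.1, k) ∉ S := by
  by_contra! hk
  exact hy ⟨h, hk⟩

theorem column_reachable {X : Set Hex} {p : ℤ} (k : ℤ) (n : ℕ)
    (h : ∀ j, k ≤ j → j ≤ k + n → (p, j) ∈ X) :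
    (assemblyGraph X).Reachable (p, k) (p, k + n) := by
  induction n with
  | zero => simp
  | succ n ih =>
    refine (ih fun j h1 h2 => h j h1 (by push_cast; omega)).trans (Adj.reachable ?_)
    rw [adj_iff]
    exact ⟨h _ (by omega) (by push_cast; omega), h _ (by push_cast; omega) le_rfl,
      Or.inl ⟨rfl, Or.inl (by push_cast; ring)⟩⟩

theorem reachable_of_mem_segment (h : y ∈ segment S x) :
    (assemblyGraph (segment S x)).Reachable x y := by
  obtain ⟨p, q⟩ := x
  obtain ⟨p', r⟩ := y
  obtain rfl : p' = p := h.1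
  have hmem : ∀ j, min q r ≤ j → j ≤ max q r → (p', j) ∈ segment S (p', q) := fun j h1 h2 =>
    ⟨rfl, fun k h3 h4 => h.2 k (by grind) (by grind)⟩
  rcases le_total q r with hqr | hqr
  · obtain ⟨n, rfl⟩ := Int.le.dest hqr
    exact column_reachable q n fun j h1 h2 => hmem j (by omega) (by omega)
  · obtain ⟨n, rfl⟩ := Int.le.dest hqr
    exact (column_reachable r n fun j h1 h2 => hmem j (by omega) (by omega)).symm

end Segment

/-! ### Hole-free shapes are trees of segments -/

/-- The number, modulo two, of crossings of an edge with a ray that leaves `y` in the forward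
direction, tilted to the left by an infinitesimal angle. -/
def crossingLeft (y a b : Hex) : ZMod 2 :=
  if (a.1 = y.1 ∧ b.1 = y.1 - 1 ∧ y.2 < a.2) ∨ (b.1 = y.1 ∧ a.1 = y.1 - 1 ∧ y.2 < b.2)
  then 1 else 0

theorem crossing_eq (y a b : Hex) : crossing y a b =
    if (a.1 = y.1 ∧ b.1 = y.1 + 1 ∧ y.2 < a.2) ∨ (b.1 = y.1 ∧ a.1 = y.1 + 1 ∧ y.2 < b.2)
    then 1 else 0 :=
  if_congr Iff.rfl rfl rfl

section Tree

variable {S : Set Hex}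

theorem HoleFreeShape.exists_potential (hS : HoleFreeShape S) {y : Hex} (hy : y ∉ S) :
    ∃ φ : Hex → ZMod 2, ∀ a b, (assemblyGraph S).Adj a b → crossing y a b = φ a + φ b :=
  exists_crossing_potential hy fun v c hc he => hy (hS v c hc y he)

/-- Tilting the ray to the other side changes the crossing numbers by the coboundary of the
indicator of the cells ahead of `y` in its column. This would fail for the edge from `y` to the cell
ahead of it, which `y ∉ S` excludes. -/
theorem HoleFreeShape.exists_potential_left (hS : HoleFreeShape S) {y : Hex} (hy : y ∉ S) :
    ∃ φ : Hex → ZMod 2, ∀ a b, (assemblyGraph S).Adj a b → crossingLeft y a b = φ a + φ b := by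
  obtain ⟨φ, hφ⟩ := hS.exists_potential hy
  refine ⟨fun a => φ a + if a.1 = y.1 ∧ y.2 < a.2 then 1 else 0, fun a b hab => ?_⟩
  have h := hφ a b hab
  rw [adj_iff] at hab
  obtain ⟨ha, hb, hab⟩ := hab
  have ha' : ¬ (a.1 = y.1 ∧ a.2 = y.2) := fun h => hy (by rwa [← Prod.ext h.1 h.2])
  have hb' : ¬ (b.1 = y.1 ∧ b.2 = y.2) := fun h => hy (by rwa [← Prod.ext h.1 h.2])
  have key : crossingLeft y a b = crossing y a b + (if a.1 = y.1 ∧ y.2 < a.2 then 1 else 0) +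
      (if b.1 = y.1 ∧ y.2 < b.2 then 1 else 0) := by
    simp only [crossingLeft, crossing_eq]
    by_cases h1 : a.1 = y.1 ∧ y.2 < a.2 <;> by_cases h2 : b.1 = y.1 ∧ y.2 < b.2
    · rw [if_neg (by omega), if_neg (by omega), if_pos h1, if_pos h2]; decide
    · rcases hab with hab | hab | hab
      · omega
      · rw [if_pos (by omega), if_neg (by omega), if_pos h1, if_neg h2]; decide
      · rw [if_neg (by omega), if_pos (by omega), if_pos h1, if_neg h2]; decide
    · rcases hab with hab | hab | hab
      · omega
      · rw [if_neg (by omega), if_pos (by omega), if_neg h1, if_pos h2]; decide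
      · rw [if_pos (by omega), if_neg (by omega), if_neg h1, if_pos h2]; decide
    · rw [if_neg (by omega), if_neg (by omega), if_neg h1, if_neg h2]; decide
  rw [key, h]
  ring

theorem potential_eq_of_reachable {X : Set Hex} {h : Hex → Hex → ZMod 2} {φ : Hex → ZMod 2}
    (hX : X ⊆ S) (hφ : ∀ a b, (assemblyGraph S).Adj a b → h a b = φ a + φ b)
    (h0 : ∀ a b, (assemblyGraph X).Adj a b → h a b = 0) {a b : Hex}
    (hab : (assemblyGraph X).Reachable a b) : φ a = φ b := by
  obtain ⟨p⟩ := hab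
  induction p with
  | nil => rfl
  | @cons a c b e p ih =>
    have := hφ _ _ (assemblyGraph_mono hX e)
    rw [h0 _ _ e, eq_comm, CharTwo.add_eq_zero] at this
    rw [this, ih]

/-- Two weights with a potential on `S` that agree on the edges of a segment and of its complement
have equally many differences on any two edges joining the segment to a connected set. -/
theorem weight_eq_of_reachable {h₁ h₂ : Hex → Hex → ZMod 2}
    (p₁ : ∃ φ : Hex → ZMod 2, ∀ a b, (assemblyGraph S).Adj a b → h₁ a b = φ a + φ b)
    (p₂ : ∃ φ : Hex → ZMod 2, ∀ a b, (assemblyGraph S).Adj a b → h₂ a b = φ a + φ b)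
    {a₁ a₂ b₁ b₂ : Hex} (hb : b₂ ∈ segment S b₁)
    (h₁₂ : ∀ a b, (assemblyGraph (S \ segment S b₁)).Adj a b → h₁ a b = h₂ a b)
    (hcol : ∀ a b, a.1 = b.1 → h₁ a b = h₂ a b)
    (e₁ : (assemblyGraph S).Adj b₁ a₁) (e₂ : (assemblyGraph S).Adj b₂ a₂)
    (hr : (assemblyGraph (S \ segment S b₁)).Reachable a₁ a₂) :
    h₁ b₁ a₁ + h₂ b₁ a₁ = h₁ b₂ a₂ + h₂ b₂ a₂ := by
  obtain ⟨φ₁, hφ₁⟩ := p₁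
  obtain ⟨φ₂, hφ₂⟩ := p₂
  have hφ : ∀ a b, (assemblyGraph S).Adj a b →
      h₁ a b + h₂ a b = (φ₁ a + φ₂ a) + (φ₁ b + φ₂ b) := fun a b hab => by
    rw [hφ₁ a b hab, hφ₂ a b hab]; ring
  have ea := potential_eq_of_reachable (h := fun a b => h₁ a b + h₂ a b)
    (φ := fun a => φ₁ a + φ₂ a) Set.sdiff_subset hφ
    (fun a b hab => by simp only [h₁₂ a b hab]; exact CharTwo.add_self_eq_zero _) hr
  have eb := potential_eq_of_reachable (h := fun a b => h₁ a b + h₂ a b)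
    (φ := fun a => φ₁ a + φ₂ a) segment_subset hφ
    (fun a b hab => by
      have hc : a.1 = b.1 := hab.1.1.trans hab.2.1.1.symm
      simp only [hcol a b hc]; exact CharTwo.add_self_eq_zero _)
    (reachable_of_mem_segment hb)
  rw [hφ _ _ e₁, hφ _ _ e₂, ea, eb]

theorem crossingLeft_eq_zero_of_fst_eq {y a b : Hex} (h : a.1 = b.1) : crossingLeft y a b = 0 := by
  unfold crossingLeft
  rw [if_neg]
  omega

/-! ### Comparing two rays beside a segment -/

section Separation

variable {a₁ a₂ b₁ b₂ : Hex}

/-- Compare the right-tilted rays from the cells just below and just above the segment. Other cells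
of `S` in the column are ahead of both or of neither, so the crossings differ only on edges leaving
the segment to the right. -/
theorem not_left_and_right (hfin : S.Finite) (hS : HoleFreeShape S) (hb : b₂ ∈ segment S b₁)
    (e₁ : (assemblyGraph S).Adj b₁ a₁) (e₂ : (assemblyGraph S).Adj b₂ a₂)
    (hr : (assemblyGraph (S \ segment S b₁)).Reachable a₁ a₂)
    (h₁ : a₁.1 = b₁.1 - 1) (h₂ : a₂.1 = b₁.1 + 1) : False := by
  obtain ⟨l, u, hl, hu, hseg⟩ := exists_segment_bounds hfin e₁.1
  have key := weight_eq_of_reachable (hS.exists_potential hl) (hS.exists_potential hu) hb ?_ ?_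
    e₁ e₂ hr
  · have hb' := (hseg b₂).1 hb
    simp only [crossing_eq] at key
    rw [if_neg (by omega), if_neg (by omega), if_pos (by omega), if_neg (by omega)] at key
    exact absurd key (by decide)
  · intro a b hab
    have ha := lt_or_lt_of_notMem_segment hl hu hseg hab.1.1 hab.1.2
    have hb := lt_or_lt_of_notMem_segment hl hu hseg hab.2.1.1 hab.2.1.2
    have := (hseg b₁).1 (mem_segment_self e₁.1)
    rw [crossing_eq, crossing_eq]
    exact if_congr (by simp only; omega) rfl rfl
  · intro a b hab
    rw [crossing_eq_zero_of_fst_eq hab, crossing_eq_zero_of_fst_eq hab]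

/-- Compare the right-tilted ray from the cell above the segment with the left-tilted ray from `z`.
Both run up between the same two columns and cross the same edges away from the segment, but only
the ray from `z` crosses the upper contact `b₁ a₁`, and neither crosses `b₂ a₂`. -/
theorem not_separated_right (hfin : S.Finite) (hS : HoleFreeShape S) (hb : b₂ ∈ segment S b₁)
    (e₁ : (assemblyGraph S).Adj b₁ a₁) (e₂ : (assemblyGraph S).Adj b₂ a₂)
    (hr : (assemblyGraph (S \ segment S b₁)).Reachable a₁ a₂)
    (h₁ : a₁.1 = b₁.1 + 1) (h₂ : a₂.1 = b₁.1 + 1) {z : Hex} (hz : z ∉ S) (hz1 : z.1 = a₁.1)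
    (hz2 : a₂.2 < z.2) (hz3 : z.2 < a₁.2) : False := by
  obtain ⟨l, u, hl, hu, hseg⟩ := exists_segment_bounds hfin e₁.1
  have hb' := (hseg b₂).1 hb
  have hb1 := (hseg b₁).1 (mem_segment_self e₁.1)
  have e₁' := (adj_iff.1 e₁).2.2
  have e₂' := (adj_iff.1 e₂).2.2
  have key := weight_eq_of_reachable (hS.exists_potential hu) (hS.exists_potential_left hz) hb ?_ ?_
    e₁ e₂ hr
  · simp only [crossing_eq, crossingLeft] at key
    rw [if_neg (by omega), if_pos (by omega), if_neg (by omega), if_neg (by omega)] at key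
    exact absurd key (by decide)
  · intro a b hab
    have ha := lt_or_lt_of_notMem_segment hl hu hseg hab.1.1 hab.1.2
    have hb := lt_or_lt_of_notMem_segment hl hu hseg hab.2.1.1 hab.2.1.2
    have hab' := (adj_iff.1 hab).2.2
    rw [crossing_eq, crossingLeft]
    exact if_congr (by simp only; omega) rfl rfl
  · intro a b hab
    rw [crossing_eq_zero_of_fst_eq hab, crossingLeft_eq_zero_of_fst_eq hab]

theorem not_separated_left (hfin : S.Finite) (hS : HoleFreeShape S) (hb : b₂ ∈ segment S b₁)
    (e₁ : (assemblyGraph S).Adj b₁ a₁) (e₂ : (assemblyGraph S).Adj b₂ a₂)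
    (hr : (assemblyGraph (S \ segment S b₁)).Reachable a₁ a₂)
    (h₁ : a₁.1 = b₁.1 - 1) (h₂ : a₂.1 = b₁.1 - 1) {z : Hex} (hz : z ∉ S) (hz1 : z.1 = a₁.1)
    (hz2 : a₂.2 < z.2) (hz3 : z.2 < a₁.2) : False := by
  obtain ⟨l, u, hl, hu, hseg⟩ := exists_segment_bounds hfin e₁.1
  have hb' := (hseg b₂).1 hb
  have hb1 := (hseg b₁).1 (mem_segment_self e₁.1)
  have e₁' := (adj_iff.1 e₁).2.2
  have e₂' := (adj_iff.1 e₂).2.2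
  have key := weight_eq_of_reachable (hS.exists_potential hz) (hS.exists_potential_left hu) hb ?_ ?_
    e₁ e₂ hr
  · simp only [crossing_eq, crossingLeft] at key
    rw [if_pos (by omega), if_neg (by omega), if_neg (by omega), if_neg (by omega)] at key
    exact absurd key (by decide)
  · intro a b hab
    have ha := lt_or_lt_of_notMem_segment hl hu hseg hab.1.1 hab.1.2
    have hb := lt_or_lt_of_notMem_segment hl hu hseg hab.2.1.1 hab.2.1.2
    have hab' := (adj_iff.1 hab).2.2
    rw [crossing_eq, crossingLeft]
    exact if_congr (by simp only; omega) rfl rfl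
  · intro a b hab
    rw [crossing_eq_zero_of_fst_eq hab, crossingLeft_eq_zero_of_fst_eq hab]

/-- A connected set disjoint from a segment touches it in cells of at most one segment of the
adjacent columns. -/
theorem mem_segment_of_reachable (hfin : S.Finite) (hS : HoleFreeShape S)
    (hb : b₂ ∈ segment S b₁)
    (e₁ : (assemblyGraph S).Adj b₁ a₁) (e₂ : (assemblyGraph S).Adj b₂ a₂)
    (hr : (assemblyGraph (S \ segment S b₁)).Reachable a₁ a₂)
    (h₁ : a₁.1 ≠ b₁.1) (h₂ : a₂.1 ≠ b₁.1) : a₂ ∈ segment S a₁ := by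
  have e₁' := (adj_iff.1 e₁).2.2
  have e₂' := (adj_iff.1 e₂).2.2
  have hb2 : b₂.1 = b₁.1 := hb.1
  have hr' : (assemblyGraph (S \ segment S b₂)).Reachable a₂ a₁ := by
    rw [segment_eq hb]; exact hr.symm
  have hbs := mem_segment_comm hb
  by_contra hne
  have hcases : (a₁.1 = b₁.1 - 1 ∨ a₁.1 = b₁.1 + 1) ∧ (a₂.1 = b₁.1 - 1 ∨ a₂.1 = b₁.1 + 1) := by
    omega
  rcases hcases with ⟨h | h, h' | h'⟩
  · obtain ⟨k, hk1, hk2, hk⟩ := exists_notMem_between (h'.trans h.symm) hne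
    have n1 : k ≠ a₁.2 := fun h => hk (h ▸ e₁.2.1)
    have n2 : k ≠ a₂.2 := fun h0 => hk (by rw [h0, h, ← h']; exact e₂.2.1)
    rcases lt_or_gt_of_ne n1 with hlt | hlt
    · exact not_separated_left hfin hS hb e₁ e₂ hr h h' hk rfl (by simp only; omega) hlt
    · exact not_separated_left hfin hS hbs e₂ e₁ hr' (by omega) (by omega) hk
        (by simp only; omega) hlt (by simp only; omega)
  · exact not_left_and_right hfin hS hb e₁ e₂ hr h h'
  · exact not_left_and_right hfin hS hbs e₂ e₁ hr' (by omega) (by omega)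
  · obtain ⟨k, hk1, hk2, hk⟩ := exists_notMem_between (h'.trans h.symm) hne
    have n1 : k ≠ a₁.2 := fun h => hk (h ▸ e₁.2.1)
    have n2 : k ≠ a₂.2 := fun h0 => hk (by rw [h0, h, ← h']; exact e₂.2.1)
    rcases lt_or_gt_of_ne n1 with hlt | hlt
    · exact not_separated_right hfin hS hb e₁ e₂ hr h h' hk rfl (by simp only; omega) hlt
    · exact not_separated_right hfin hS hbs e₂ e₁ hr' (by omega) (by omega) hk
        (by simp only; omega) hlt (by simp only; omega)

end Separation

end Tree

/-! ### Parent segments -/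

/-- The cell `a` is connected to the root `r` outside the segment of `b`. For neighbours `a`, `b` in
different columns this says that the segment of `a` precedes that of `b` in the tree of segments
rooted at `r`. -/
def IsParent (S : Set Hex) (r a b : Hex) : Prop :=
  r ∉ segment S b ∧ (assemblyGraph (S \ segment S b)).Reachable r a

section Parent

variable {S X : Set Hex} {r a a' b b' x y : Hex}

theorem IsParent.congr_right (h : IsParent S r a b) (hb : b' ∈ segment S b) :
    IsParent S r a b' := by
  unfold IsParent
  rwa [segment_eq hb]

theorem IsParent.congr_left (h : IsParent S r a b) (ha : a' ∈ segment S a) (hab : a.1 ≠ b.1) :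
    IsParent S r a' b := by
  refine ⟨h.1, h.2.trans ((reachable_of_mem_segment ha).mono (assemblyGraph_mono ?_))⟩
  exact fun c hc => ⟨segment_subset hc, fun hcb => hab (hc.1.symm.trans hcb.1)⟩

/-- A segment has at most one parent segment. -/
theorem IsParent.unique (hfin : S.Finite) (hS : HoleFreeShape S) (h : IsParent S r a b)
    (h' : IsParent S r a' b') (hb : b' ∈ segment S b) (e : (assemblyGraph S).Adj b a)
    (e' : (assemblyGraph S).Adj b' a') (ha : a.1 ≠ b.1) (ha' : a'.1 ≠ b.1) :
    a' ∈ segment S a :=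
  mem_segment_of_reachable hfin hS hb e e'
    (h.2.symm.trans (h'.congr_right (mem_segment_comm hb)).2) ha ha'

/-- A walk from the root to `x` meets one of the two segments first. Up to then it avoids the other,
so the segment met first is the parent. -/
theorem isParent_or_isParent (e : (assemblyGraph S).Adj x y) (hxy : x.1 ≠ y.1)
    (hr : (assemblyGraph S).Reachable r x) (hrS : r ∈ S) :
    IsParent S r x y ∨ IsParent S r y x := by
  suffices h : ∀ v c (p : (assemblyGraph S).Walk v c), v ∈ S → c ∈ segment S x →
      (∃ a ∈ segment S x, IsParent S v a y) ∨ (∃ b ∈ segment S y, IsParent S v b x) by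
    obtain ⟨p⟩ := hr
    rcases h r x p hrS (mem_segment_self e.1) with ⟨a, ha, h⟩ | ⟨b, hb, h⟩
    · exact Or.inl (h.congr_left (mem_segment_comm ha) (by rw [ha.1]; exact hxy))
    · exact Or.inr (h.congr_left (mem_segment_comm hb) (by rw [hb.1]; exact hxy.symm))
  intro v c p hv hc
  have hdisj : ∀ a, a ∈ segment S x → a ∉ segment S y := fun a h1 h2 =>
    hxy (h1.1.symm.trans h2.1)
  induction p with
  | nil => exact Or.inl ⟨_, hc, hdisj _ hc, Reachable.rfl⟩
  | @cons v u c e' p ih =>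
    by_cases hvx : v ∈ segment S x
    · exact Or.inl ⟨v, hvx, hdisj v hvx, Reachable.rfl⟩
    by_cases hvy : v ∈ segment S y
    · exact Or.inr ⟨v, hvy, hvx, Reachable.rfl⟩
    rcases ih e'.2.1 hc with ⟨a, ha, h⟩ | ⟨b, hb, h⟩
    · have e'' : (assemblyGraph (S \ segment S y)).Adj v u := ⟨⟨hv, hvy⟩, ⟨e'.2.1, h.1⟩, e'.2.2⟩
      exact Or.inl ⟨a, ha, hvy, e''.reachable.trans h.2⟩
    · have e'' : (assemblyGraph (S \ segment S x)).Adj v u := ⟨⟨hv, hvx⟩, ⟨e'.2.1, h.1⟩, e'.2.2⟩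
      exact Or.inr ⟨b, hb, hvx, e''.reachable.trans h.2⟩

theorem isParent_of_disjoint (hX : X ⊆ S) (hr : r ∈ X) (hx : (assemblyGraph X).Reachable r x)
    (hd : ∀ c ∈ X, c ∉ segment S b) : IsParent S r x b :=
  ⟨hd r hr, hx.mono (assemblyGraph_mono fun c hc => ⟨hX hc, hd c hc⟩)⟩

/-- A connected set that contains the root meets every segment it reaches next to the parent of
that segment. -/
theorem exists_isParent (hX : X ⊆ S) (hr : r ∈ X) (hx : (assemblyGraph X).Reachable r x)
    (hxS : x ∈ S) (hrx : r ∉ segment S x) :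
    ∃ a b, b ∈ X ∧ b ∈ segment S x ∧ (assemblyGraph S).Adj b a ∧ a.1 ≠ b.1 ∧
      IsParent S r a b := by
  obtain ⟨p⟩ := hx
  induction p with
  | nil => exact absurd (mem_segment_self hxS) hrx
  | @cons v u x e p ih =>
    have he := assemblyGraph_mono hX e
    by_cases hu : u ∈ segment S x
    · refine ⟨v, u, e.2.1, hu, he.symm, fun h => hrx ?_, ?_, Reachable.rfl⟩
      · refine mem_segment_trans hu (mem_segment_of_near he.2.1 he.1 h ?_ ?_) <;>
          have := (adj_iff.1 he).2.2 <;> omega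
      · rwa [segment_eq hu]
    · obtain ⟨a, b, h1, h2, h3, h4, h5⟩ := ih e.2.1 hxS hu
      have e' : (assemblyGraph (S \ segment S b)).Adj v u :=
        ⟨⟨he.1, by rwa [segment_eq h2]⟩, ⟨he.2.1, by rwa [segment_eq h2]⟩, e.2.2⟩
      exact ⟨a, b, h1, h2, h3, h4, by rwa [segment_eq h2], e'.reachable.trans h5.2⟩

end Parent

/-! ### Statuses and nucleation sites -/

section Nucleation

variable {Xb S V : Set Hex} {x x' : Hex} {w w' : Wall} {f : Flank}

theorem status_eq_free (hT : target Xb = S) :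
    status Xb V x w = .free ↔ x + dir w ∈ S ∧ x + dir w ∉ V := by
  unfold status; rw [hT]; split_ifs <;> simp_all

theorem status_eq_occupied (hT : target Xb = S) :
    status Xb V x w = .occupied ↔ x + dir w ∈ S ∧ x + dir w ∈ V := by
  unfold status; rw [hT]; split_ifs <;> simp_all

theorem status_eq_null (hT : target Xb = S) : status Xb V x w = .null ↔ x + dir w ∉ S := by
  unfold status; rw [hT]; split_ifs <;> simp_all

/-- A cell whose robot may set the flag of flank `f`. -/
def NucSite (Xb S : Set Hex) (x : Hex) (f : Flank) : Prop :=
  (∃ w ∈ f.walls, x + dir w ∈ S ∧ x + dir (w + 1) ∉ S ∧ x + dir (w - 1) ∉ S) ∨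
    roleFromColumn Xb x f = true

/-- Forgetting which walls are free makes the site a property of the shape alone, so that flags set
at different times can be compared. -/
theorem nucSite_of_nucleates (hT : target Xb = S) (h : nucleates Xb V x f = true) :
    NucSite Xb S x f := by
  unfold nucleates roleFromSelf at h
  split_ifs at h with h1 h2
  · obtain ⟨w, hw, h3, h4, h5⟩ := h2
    rw [status_eq_free hT] at h3
    rw [status_eq_null hT] at h4 h5
    exact Or.inl ⟨w, hw, h3.1, h4, h5⟩
  · exact Or.inr h
  · exact absurd h (by simp)

theorem nucleates_eq_false (hT : target Xb = S) (h : ∀ w ∈ f.walls, x + dir w ∈ S → x + dir w ∈ V) :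
    nucleates Xb V x f = false := by
  unfold nucleates roleFromSelf
  rw [if_neg]
  · rfl
  · rintro ⟨w, hw, h1⟩
    rw [status_eq_free hT] at h1
    exact h1.2 (h w hw h1.1)

theorem fst_add_dir (hw : w ∈ f.walls) : (x + dir w).1 = x.1 + f.column := by
  cases f <;> rcases hw with rfl | rfl <;> rfl

theorem mem_segment_of_flank (hw : w ∈ f.walls) (hw' : w' ∈ f.walls) (h : x + dir w ∈ S)
    (h' : x + dir w' ∈ S) : x + dir w' ∈ segment S (x + dir w) := by
  refine mem_segment_of_near h h' ((fst_add_dir hw').trans (fst_add_dir hw).symm) ?_ ?_ <;>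
  · cases f <;> rcases hw with rfl | rfl <;> rcases hw' with rfl | rfl <;>
      (simp [dir]; try omega)

theorem segmentRows_eq (hT : target Xb = S) :
    segmentRows Xb x = {q | (x.1, q) ∈ segment S x} := by
  ext q
  simp only [segmentRows, hT, segment, Set.mem_ofPred_eq, Set.uIcc, Set.mem_Icc, true_and]
  exact ⟨fun h k h1 h2 => h k ⟨h1, h2⟩, fun h k h1 => h k h1.1 h1.2⟩

theorem facingRows_eq (hT : target Xb = S) (hw : w ∈ f.walls) (h : x + dir w ∈ S) :
    facingRows Xb x f = {q | (x.1 + f.column, q) ∈ segment S (x + dir w)} := by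
  ext q
  simp only [facingRows, segmentRows_eq hT, hT, Set.mem_ofPred_eq]
  constructor
  · rintro ⟨w', hw', h', hq⟩
    rw [fst_add_dir hw'] at hq
    rwa [← segment_eq (mem_segment_of_flank hw hw' h h')]
  · intro hq
    exact ⟨w, hw, h, by rwa [fst_add_dir hw]⟩

/-- A cell whose wall touches another segment between two null walls is the only contact of the
two segments. -/
theorem eq_of_isolated_contact {w₀ : Wall} (hw₀ : w₀ ∈ f.walls) (h₀ : x + dir w₀ ∈ S)
    (h₁ : x + dir (w₀ + 1) ∉ S) (h₂ : x + dir (w₀ - 1) ∉ S) (hx' : x' ∈ segment S x)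
    (hw : w ∈ f.walls) (hw' : w' ∈ f.walls) (hxw : x + dir w ∈ S)
    (h' : x' + dir w' ∈ segment S (x + dir w)) : x' = x := by
  rw [segment_eq (mem_segment_of_flank hw₀ hw h₀ hxw)] at h'
  obtain ⟨p, q⟩ := x
  obtain ⟨p', q'⟩ := x'
  obtain rfl : p' = p := hx'.1
  have hA : ∀ k, min q q' ≤ k → k ≤ max q q' → (p', k) ∈ S := hx'.2
  have hB := h'.2
  -- A second contact would put one of the two null neighbours on the contiguous stretch `hA` or
  -- `hB` between the contacts, hence in `S`.
  refine Prod.ext rfl ?_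
  by_contra hne
  change q' ≠ q at hne
  rcases f with _ | _ <;> rcases hw₀ with rfl | rfl <;> rcases lt_or_gt_of_ne hne with hlt | hlt
  · refine h₁ (Set.mem_of_eq_of_mem (by simp [dir]) (hB q ?_ ?_)) <;>
      rcases hw' with rfl | rfl <;> simp [dir] <;> omega
  · exact h₂ (Set.mem_of_eq_of_mem (by simp [dir]) (hA (q + 1) (by omega) (by omega)))
  · exact h₁ (Set.mem_of_eq_of_mem (by simp [dir]; try omega) (hA (q - 1) (by omega) (by omega)))
  · refine h₂ (Set.mem_of_eq_of_mem (by simp [dir]) (hB (q + 1) ?_ ?_)) <;>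
      rcases hw' with rfl | rfl <;> simp [dir] <;> omega
  · exact h₂ (Set.mem_of_eq_of_mem (by simp [dir]; try omega) (hA (q - 1) (by omega) (by omega)))
  · refine h₁ (Set.mem_of_eq_of_mem (by simp [dir]) (hB q ?_ ?_)) <;>
      rcases hw' with rfl | rfl <;> simp [dir] <;> omega
  · refine h₂ (Set.mem_of_eq_of_mem (by simp [dir]; omega) (hB (q - 1) ?_ ?_)) <;>
      rcases hw' with rfl | rfl <;> simp [dir] <;> omega
  · exact h₁ (Set.mem_of_eq_of_mem (by simp [dir]) (hA (q + 1) (by omega) (by omega)))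

theorem roleFromColumn_eq_true (h : roleFromColumn Xb x f = true) :
    x.2 = midRow (facingRows Xb x f) ∨
      midRow (facingRows Xb x f) ∉ segmentRows Xb x ∧
      x.2 ∈ facingRows Xb x f ∩ segmentRows Xb x ∧
      ∀ k ∈ facingRows Xb x f ∩ segmentRows Xb x,
        |x.2 - midRow (facingRows Xb x f)| ≤ |k - midRow (facingRows Xb x f)| := by
  simp only [roleFromColumn] at h
  split_ifs at h with h1 h2 h3
  · exact Or.inl h2
  · exact Or.inr ⟨h3, by simpa only [decide_eq_true_eq] using h⟩

/-- Both cells use the same midpoint row `m` and the same two segments. If `m` is a row of their own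
segment, both lie on it. Otherwise both are nearest to `m` among the same rows, and equidistant rows
on opposite sides of `m` would put `m` in their contiguous segment. -/
theorem eq_of_roleFromColumn (hT : target Xb = S) (h : roleFromColumn Xb x f = true)
    (h' : roleFromColumn Xb x' f = true) (hx' : x' ∈ segment S x)
    (hw : w ∈ f.walls) (hw' : w' ∈ f.walls) (hxw : x + dir w ∈ S)
    (hxw' : x' + dir w' ∈ segment S (x + dir w)) : x' = x := by
  have hface : facingRows Xb x' f = facingRows Xb x f := by
    rw [facingRows_eq hT hw hxw, facingRows_eq hT hw' (segment_subset hxw'), segment_eq hxw', hx'.1]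
  have hrow : segmentRows Xb x' = segmentRows Xb x := by
    rw [segmentRows_eq hT, segmentRows_eq hT, segment_eq hx', hx'.1]
  have hself : x.2 ∈ segmentRows Xb x := by
    rw [segmentRows_eq hT]; exact mem_segment_self (segment_subset (mem_segment_comm hx'))
  have hself' : x'.2 ∈ segmentRows Xb x := by
    rw [segmentRows_eq hT, Set.mem_ofPred_eq, ← hx'.1]; exact hx'
  have h := roleFromColumn_eq_true h
  have h' := roleFromColumn_eq_true h'
  rw [hface, hrow] at h'
  refine Prod.ext hx'.1 ?_
  generalize midRow (facingRows Xb x f) = m at *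
  rcases h with h | ⟨g, h1, h2⟩ <;> rcases h' with h' | ⟨g', h1', h2'⟩
  · omega
  · exact absurd (h ▸ hself) g'
  · exact absurd (h' ▸ hself') g
  · have i1 := h2 _ h1'
    have i2 := h2' _ h1
    by_contra hne
    refine g ?_
    rw [segmentRows_eq hT] at hself' ⊢
    refine ⟨rfl, fun k k3 k4 => hself'.2 k ?_ ?_⟩ <;> grind

/-- The nucleation site between two adjacent segments is unique. -/
theorem NucSite.unique (hT : target Xb = S) (h : NucSite Xb S x f)
    (h' : NucSite Xb S x' f) (hx' : x' ∈ segment S x)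
    (hw : w ∈ f.walls) (hw' : w' ∈ f.walls) (hxw : x + dir w ∈ S)
    (hxw' : x' + dir w' ∈ segment S (x + dir w)) : x' = x := by
  rcases h with ⟨w₀, hw₀, h0, h1, h2⟩ | h
  · exact eq_of_isolated_contact hw₀ h0 h1 h2 hx' hw hw' hxw hxw'
  rcases h' with ⟨w₀, hw₀, h0, h1, h2⟩ | h'
  · exact (eq_of_isolated_contact hw₀ h0 h1 h2 (mem_segment_comm hx') hw' hw
      (segment_subset hxw') (mem_segment_comm hxw')).symm
  · exact eq_of_roleFromColumn hT h h' hx' hw hw' hxw hxw'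

end Nucleation

/-! ### Walls and signals -/

/-- The wall of flank `f` next to the fore-aft wall `w`. -/
def Flank.side : Flank → Wall → Wall
  | .left, w => if w = 0 then 1 else 2
  | .right, w => if w = 0 then 5 else 4

/-- The flag of a flank. -/
def Memory.nuc (m : Memory) : Flank → Bool
  | .left => m.nucLeft
  | .right => m.nucRight

theorem dir_side (f : Flank) {w : Wall} (hw : w ∈ foreAft) :
    dir (f.side w) = dir w + dir (f.side (w + 3)) := by
  cases f <;> rcases hw with rfl | rfl <;> decide

theorem eq_side_of_mem_walls {f : Flank} {u w : Wall} (hu : u ∈ f.walls) (hw : w ∈ foreAft) :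
    u = f.side w ∨ u = f.side (w + 3) := by
  cases f <;> rcases hw with rfl | rfl <;> rcases hu with rfl | rfl <;> decide

theorem side_mem_walls (f : Flank) (w : Wall) : f.side w ∈ f.walls := by
  cases f <;> simp only [Flank.side] <;> split_ifs <;> simp [Flank.walls]

theorem fst_add_dir_ne {f : Flank} {w : Wall} (hw : w ∈ f.walls) (x : Hex) :
    (x + dir w).1 ≠ x.1 := by
  rw [fst_add_dir hw]
  cases f <;> simp [Flank.column]

theorem exists_flank_opposite {f : Flank} {w : Wall} (hw : w ∈ f.walls) :
    ∃ f' : Flank, w + 3 ∈ f'.walls := by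
  cases f
  · exact ⟨.right, by rcases hw with rfl | rfl <;> simp [Flank.walls]⟩
  · exact ⟨.left, by rcases hw with rfl | rfl <;> simp [Flank.walls]⟩

theorem add_dir_add_dir_opposite (x : Hex) (w : Wall) : x + dir w + dir (w + 3) = x := by
  rw [dir_add_three]; abel

section Signal

variable {Xb S X : Set Hex} {x : Hex} {m : Memory} {w : Wall}

theorem mem_of_mem_signals (hT : target Xb = S) (h : w ∈ signals Xb X x m) :
    x + dir w ∈ S ∧ x + dir w ∉ X := by
  rw [← status_eq_free (Xb := Xb) hT]
  have h1 := h.1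
  unfold nominalWalls at h1
  split_ifs at h1
  · exact h1.2
  · rcases h1 with (h1 | h1) | h1
    · exact h1.2.1
    · exact h1.2.2
    · exact h1.2.2

/-- The conditions under which a wall signals, in terms of cells. -/
theorem signals_cases (hT : target Xb = S) (h : w ∈ signals Xb X x m) :
    (w ∈ foreAft ∧ ∀ f : Flank, m.growth = -f.column → x + dir (f.side w) ∈ S →
      x + dir (f.side w) ∈ X → x + dir (f.side w) + dir w ∈ S → x + dir (f.side w) + dir w ∈ X) ∨
    ∃ f : Flank, w ∈ f.walls ∧ (∀ v ∈ foreAft, x + dir v ∈ S → x + dir v ∈ X) ∧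
      ((∃ w' ∈ f.walls, x + dir w' ∈ X) ∨ m.nuc f = true) := by
  obtain ⟨h1, h2⟩ := h
  unfold nominalWalls at h1
  split_ifs at h1 with h0
  · refine Or.inl ⟨h1.1, fun f hf hs hX hs' => ?_⟩
    by_contra hX'
    refine h2 ?_
    have hocc := (status_eq_occupied (Xb := Xb) hT).2 ⟨hs, hX⟩
    have hfree := (status_eq_free (Xb := Xb) hT).2 ⟨hs', hX'⟩
    cases f <;> rcases h1.1 with rfl | rfl
    · exact Or.inr ⟨hf, Or.inl ⟨rfl, hocc, hfree⟩⟩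
    · exact Or.inr ⟨hf, Or.inr ⟨rfl, hocc, hfree⟩⟩
    · exact Or.inl ⟨hf, Or.inl ⟨rfl, hocc, hfree⟩⟩
    · exact Or.inl ⟨hf, Or.inr ⟨rfl, hocc, hfree⟩⟩
  · refine Or.inr ?_
    have hfa : ∀ v ∈ foreAft, x + dir v ∈ S → x + dir v ∈ X := by
      intro v hv hs
      by_contra hX
      have hfree := (status_eq_free (Xb := Xb) hT).2 ⟨hs, hX⟩
      rcases hv with rfl | rfl
      · exact h0 (Or.inl hfree)
      · exact h0 (Or.inr hfree)
    simp only [status_eq_occupied hT, status_eq_null hT] at h1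
    rcases h1 with (⟨hw, -, h1⟩ | ⟨h1, hw, -⟩) | ⟨h1, hw, -⟩
    · have hw' : w = 1 ∨ w = 2 ∨ w = 4 ∨ w = 5 := by
        fin_cases w <;> simp_all [foreAft]
      rcases hw' with rfl | rfl | rfl | rfl
      · refine ⟨.left, by simp [Flank.walls], hfa, Or.inl ⟨2, by simp [Flank.walls], ?_⟩⟩
        rcases h1 with h1 | h1 | h1
        · exact h1.1.2
        · exact absurd h1.1 (by simp [foreAft])
        · exact h1.2.2.2
      · refine ⟨.left, by simp [Flank.walls], hfa, Or.inl ⟨1, by simp [Flank.walls], ?_⟩⟩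
        rcases h1 with h1 | h1 | h1
        · exact h1.2.2
        · exact h1.2.2.2
        · exact absurd h1.1 (by simp [foreAft])
      · refine ⟨.right, by simp [Flank.walls], hfa, Or.inl ⟨5, by simp [Flank.walls], ?_⟩⟩
        rcases h1 with h1 | h1 | h1
        · exact h1.1.2
        · exact absurd h1.1 (by simp [foreAft])
        · exact h1.2.2.2
      · refine ⟨.right, by simp [Flank.walls], hfa, Or.inl ⟨4, by simp [Flank.walls], ?_⟩⟩
        rcases h1 with h1 | h1 | h1
        · exact h1.2.2
        · exact h1.2.2.2
        · exact absurd h1.1 (by simp [foreAft])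
    · exact ⟨.left, hw, hfa, Or.inr h1⟩
    · exact ⟨.right, hw, hfa, Or.inr h1⟩

end Signal

/-! ### The invariant of executions -/

/-- The invariant: the occupied part of each segment is contiguous, a robot has no free wall towards
the parent segment and grows away from it, and a segment that is not empty is occupied next to
its nucleation site. -/
structure Invariant (Xb S : Set Hex) (σ : State) : Prop where
  root : (0, 0) ∈ occupied σ
  subset : occupied σ ⊆ S
  reachable : ∀ x ∈ occupied σ, (assemblyGraph (occupied σ)).Reachable (0, 0) x
  contiguous : ∀ x ∈ occupied σ, ∀ y ∈ occupied σ, y ∈ segment S x → ∀ z : Hex, z.1 = x.1 →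
    min x.2 y.2 ≤ z.2 → z.2 ≤ max x.2 y.2 → z ∈ occupied σ
  parent : ∀ b m, σ b = some m → ∀ (f : Flank), ∀ w ∈ f.walls, b + dir w ∈ S →
    IsParent S (0, 0) (b + dir w) b →
      b + dir w ∈ occupied σ ∧ m.nuc f = false ∧ m.growth = -f.column
  site : ∀ b m, σ b = some m → ∀ f, m.nuc f = true → NucSite Xb S b f
  nucleated : ∀ x ∈ S, ∀ (f : Flank), ∀ w ∈ f.walls, x + dir w ∈ S → NucSite Xb S x f →
    IsParent S (0, 0) x (x + dir w) → (∃ c ∈ occupied σ, c ∈ segment S (x + dir w)) →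
      ∃ w' ∈ f.walls, x + dir w' ∈ occupied σ

/-- Some robot signals towards the cell `b`. -/
def IsSignalled (Xb : Set Hex) (σ : State) (b : Hex) : Prop :=
  ∃ x m w, σ x = some m ∧ w ∈ signals Xb (occupied σ) x m ∧ b = x + dir w

theorem adj_add_dir {S : Set Hex} {x : Hex} {w : Wall} (hx : x ∈ S) (hw : x + dir w ∈ S) :
    (assemblyGraph S).Adj x (x + dir w) := ⟨hx, hw, w, rfl⟩

theorem add_dir_mem_segment {S : Set Hex} {x : Hex} {w : Wall} (hw : w ∈ foreAft) (hx : x ∈ S)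
    (h : x + dir w ∈ S) : x + dir w ∈ segment S x := by
  refine mem_segment_of_near hx h ?_ ?_ ?_ <;> rcases hw with rfl | rfl <;> (simp [dir]; try omega)

/-! ### Signalled cells under the invariant -/

section Invariant

variable {Xb S : Set Hex} {σ τ : State} {b x : Hex}

theorem initMemory_nuc (V : Set Hex) (f : Flank) :
    (initMemory Xb V b).nuc f = nucleates Xb V b f := by cases f <;> rfl

theorem Invariant.of_isInitial (hT : target Xb = S) (hroot : (0, 0) ∈ S)
    (h : IsInitial Xb σ) : Invariant Xb S σ := by
  have hocc : occupied σ = {(0, 0)} := by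
    ext x
    constructor
    · rintro ⟨m, hm⟩
      by_contra hx
      rw [h.2 x hx] at hm
      exact absurd hm (by simp)
    · rintro rfl
      exact ⟨_, h.1⟩
  have hb : ∀ b m, σ b = some m → b = (0, 0) := fun b m hm => by
    have : b ∈ occupied σ := ⟨m, hm⟩
    rwa [hocc] at this
  refine ⟨?_, ?_, ?_, ?_, ?_, ?_, ?_⟩
  · rw [hocc]; rfl
  · rw [hocc]; rintro _ rfl; exact hroot
  · rw [hocc]; rintro _ rfl; exact Reachable.rfl
  · rw [hocc]
    rintro _ rfl _ rfl - z h1 h2 h3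
    exact Prod.ext h1 (by simp at h2 h3; simp; omega)
  · intro b m hm f w hw hs hp
    -- The segment of the root has no parent.
    rw [hb b m hm] at hp
    exact absurd (mem_segment_self hroot) hp.1
  · intro b m hm f hf
    obtain rfl := hb b m hm
    rw [h.1, Option.some_inj] at hm
    subst hm
    rw [initMemory_nuc] at hf
    exact nucSite_of_nucleates hT hf
  · rintro x hx f w hw hs - hp ⟨c, hc, hcs⟩
    rw [hocc] at hc
    obtain rfl := hc
    exact absurd hcs hp.1

/-- The invariant rules out free walls towards the parent, so a free flank wall faces a child. -/
theorem Invariant.isParent_of_free (hI : Invariant Xb S σ) {m : Memory} {f : Flank} {w : Wall}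
    (hroot : (0, 0) ∈ S) (hx : σ x = some m) (hw : w ∈ f.walls) (hs : x + dir w ∈ S)
    (hn : x + dir w ∉ occupied σ) : IsParent S (0, 0) x (x + dir w) := by
  have hxo : x ∈ occupied σ := ⟨m, hx⟩
  rcases isParent_or_isParent (adj_add_dir (hI.subset hxo) hs) (fst_add_dir_ne hw x).symm
    ((hI.reachable x hxo).mono (assemblyGraph_mono hI.subset)) hroot with h | h
  · exact h
  · exact absurd (hI.parent x m hx f w hw hs h).1 hn

/-- The neighbours of a signalled cell in the parent segment are occupied. -/
theorem Invariant.parent_of_isSignalled (hfin : S.Finite) (hS : HoleFreeShape S)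
    (hT : target Xb = S) (hI : Invariant Xb S σ) (hroot : (0, 0) ∈ S) (hb : IsSignalled Xb σ b)
    {f : Flank} {u : Wall} (hu : u ∈ f.walls) (hs : b + dir u ∈ S)
    (hp : IsParent S (0, 0) (b + dir u) b) : b + dir u ∈ occupied σ := by
  obtain ⟨x, m, w, hx, hw, rfl⟩ := hb
  have hxo : x ∈ occupied σ := ⟨m, hx⟩
  have hxS := hI.subset hxo
  obtain ⟨hbS, hbX⟩ := mem_of_mem_signals hT hw
  rcases signals_cases hT hw with ⟨hw0, hdel⟩ | ⟨f', hf', hfa, -⟩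
  · have hseg := add_dir_mem_segment hw0 hxS hbS
    have hpx := hp.congr_right (mem_segment_comm hseg)
    rcases eq_side_of_mem_walls hu hw0 with rfl | rfl
    · have e1 : x + dir w + dir (f.side w) = x + dir (f.side w) + dir w := by abel
      rw [e1] at hs hp hpx ⊢
      -- The cell in question lies one step `w` ahead of the flank neighbour of `x`. If that
      -- neighbour is in `S`, it is an occupied parent cell, and the delay rule applies because `x`
      -- grows away from it.
      by_cases hn : x + dir (f.side w) ∈ S
      · have hp' := hpx.congr_left (mem_segment_comm (add_dir_mem_segment hw0 hn hs)) (by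
          rw [← e1]
          have := fst_add_dir_ne hu (x + dir w)
          rwa [hseg.1] at this)
        obtain ⟨h1, -, h3⟩ := hI.parent x m hx f _ hu hn hp'
        exact hdel f h3 hn h1 hs
      -- Here the parent segment ends beside `b`. The segment of `x` was reached through an occupied
      -- cell `c` touching the parent, which must lie beyond `b`; contiguity from `x` to `c` would
      -- make `b` occupied.
      · exfalso
        obtain ⟨a, c, hc, hcx, hca, hne, hpa⟩ := exists_isParent hI.subset hI.root
          (hI.reachable x hxo) hxS hpx.1
        have hcol := fst_add_dir_ne hu (x + dir w)
        have hadj := adj_add_dir (x := x + dir w) (w := f.side w) hbS (by rwa [e1])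
        rw [e1] at hadj hcol
        have hcb : c ∈ segment S (x + dir w) := mem_segment_trans (mem_segment_comm hseg) hcx
        have haseg := hp.unique hfin hS hpa hcb hadj hca hcol (by rwa [← hcb.1])
        have hca' := (adj_iff.1 hca).2.2
        have hcx1 := hcx.1
        have ha1 := haseg.1
        have hfst : (x + dir (f.side w) + dir w).1 = (x + dir (f.side w)).1 := by
          rcases hw0 with rfl | rfl <;> simp [dir]
        have ha2 := haseg.2 (x + dir (f.side w)).2
        rw [hfst] at ha2
        have ha3 : ¬ (min (x + dir (f.side w) + dir w).2 a.2 ≤ (x + dir (f.side w)).2 ∧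
            (x + dir (f.side w)).2 ≤ max (x + dir (f.side w) + dir w).2 a.2) :=
          fun h => hn (ha2 h.1 h.2)
        refine hbX (hI.contiguous x hxo c hc hcx _ hseg.1 ?_ ?_) <;> clear ha2 <;>
        cases f <;> rcases hw0 with rfl | rfl <;>
          simp only [Flank.side, dir, Prod.fst_add, Prod.snd_add] at ha1 ha3 hca' ⊢ <;>
          simp at ha1 ha3 hca' ⊢ <;> omega
    · rw [add_assoc, ← dir_side f hw0] at hs hp hpx ⊢
      exact (hI.parent x m hx f _ (side_mem_walls f w) hs hpx).1
  -- For a flank signal, `x` itself lies in the parent segment. The parent cell is then `x` or one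
  -- of its fore-aft neighbours, none of which is free when a flank signals.
  · have hpx := hI.isParent_of_free hroot hx hf' hbS hbX
    have hne := fst_add_dir_ne hf' x
    have h := hpx.unique hfin hS hp (mem_segment_self hbS) (adj_add_dir hxS hbS).symm
      (adj_add_dir hbS hs) hne.symm (fst_add_dir_ne hu _)
    have hadj := (adj_iff.1 (adj_add_dir hbS hs)).2.2
    have hadj' := (adj_iff.1 (adj_add_dir hxS hbS)).2.2
    have h1 := h.1
    have hcases : (x + dir w + dir u).2 = x.2 ∨ (x + dir w + dir u).2 = x.2 + 1 ∨
        (x + dir w + dir u).2 = x.2 - 1 := by omega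
    rcases hcases with h2 | h2 | h2
    · have e : x + dir w + dir u = x := Prod.ext h1 h2
      rw [e]; exact hxo
    · have e : x + dir w + dir u = x + dir 0 := Prod.ext (h1.trans (by simp [dir])) h2
      rw [e] at hs ⊢
      exact hfa 0 (by simp [foreAft]) hs
    · have e : x + dir w + dir u = x + dir 3 := Prod.ext (h1.trans (by simp [dir])) h2
      rw [e] at hs ⊢
      exact hfa 3 (by simp [foreAft]) hs

/-- A signalled cell whose segment is not empty has an occupied neighbour in its column. -/
theorem Invariant.exists_near (hT : target Xb = S) (hI : Invariant Xb S σ) (hroot : (0, 0) ∈ S)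
    (hb : IsSignalled Xb σ b) (hc : ∃ c ∈ occupied σ, c ∈ segment S b) :
    ∃ c ∈ occupied σ, c.1 = b.1 ∧ (c.2 = b.2 + 1 ∨ c.2 = b.2 - 1) := by
  obtain ⟨x, m, w, hx, hw, rfl⟩ := hb
  have hxo : x ∈ occupied σ := ⟨m, hx⟩
  have hxS := hI.subset hxo
  obtain ⟨hbS, hbX⟩ := mem_of_mem_signals hT hw
  rcases signals_cases hT hw with ⟨hw0, -⟩ | ⟨f, hf, -, hnuc⟩
  · refine ⟨x, hxo, ?_⟩
    rcases hw0 with rfl | rfl <;> simp [dir]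
  -- If the signal comes from a flag, `x` is the nucleation site, and `nucleated` makes the other
  -- wall of the flank occupied.
  · have key : ∃ w' ∈ f.walls, x + dir w' ∈ occupied σ := by
      rcases hnuc with h | h
      · exact h
      · exact hI.nucleated x hxS f w hf hbS (hI.site x m hx f h)
          (hI.isParent_of_free hroot hx hf hbS hbX) hc
    obtain ⟨w', hw', hX⟩ := key
    refine ⟨_, hX, (fst_add_dir hw').trans (fst_add_dir hf).symm, ?_⟩
    have hne : w' ≠ w := by rintro rfl; exact hbX hX
    cases f <;> rcases hf with rfl | rfl <;> rcases hw' with rfl | rfl <;>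
      first | exact absurd rfl hne | (simp [dir]; try omega)

/-- A signalled cell of an empty segment is next to a nucleation site. -/
theorem Invariant.exists_site (hT : target Xb = S) (hI : Invariant Xb S σ)
    (hb : IsSignalled Xb σ b) (hc : ∀ c ∈ occupied σ, c ∉ segment S b) :
    ∃ x f, x ∈ occupied σ ∧ NucSite Xb S x f ∧ IsParent S (0, 0) x b ∧
      ∃ w ∈ f.walls, b = x + dir w := by
  obtain ⟨x, m, w, hx, hw, rfl⟩ := hb
  have hxo : x ∈ occupied σ := ⟨m, hx⟩
  have hxS := hI.subset hxo
  obtain ⟨hbS, hbX⟩ := mem_of_mem_signals hT hw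
  rcases signals_cases hT hw with ⟨hw0, -⟩ | ⟨f, hf, -, ⟨w', hw', hX⟩ | hnuc⟩
  · exact absurd (mem_segment_comm (add_dir_mem_segment hw0 hxS hbS)) (hc x hxo)
  · exact absurd (mem_segment_of_flank hf hw' hbS (hI.subset hX)) (hc _ hX)
  · exact ⟨x, f, hxo, hI.site x m hx f hnuc,
      isParent_of_disjoint hI.subset hI.root (hI.reachable x hxo) hc, w, hf, rfl⟩

end Invariant

/-! ### Preservation of the invariant -/

section Step

variable {Xb S : Set Hex} {σ τ : State} {b x : Hex}

theorem Step.occupied_subset (h : Step Xb σ τ) : occupied σ ⊆ occupied τ :=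
  fun x ⟨m, hm⟩ => ⟨m, h.1 x m hm⟩

theorem Step.mem_or_isSignalled (h : Step Xb σ τ) (hb : b ∈ occupied τ) :
    b ∈ occupied σ ∨ IsSignalled Xb σ b := by
  obtain ⟨m, hm⟩ := hb
  cases hσ : σ b with
  | some m' => exact Or.inl ⟨m', hσ⟩
  | none => exact Or.inr (h.2 b m hσ hm).1

theorem IsSignalled.mem (hT : target Xb = S) (hb : IsSignalled Xb σ b) :
    b ∈ S ∧ b ∉ occupied σ := by
  obtain ⟨x, m, w, -, hw, rfl⟩ := hb
  exact mem_of_mem_signals hT hw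

theorem Invariant.reachable_of_isSignalled (hI : Invariant Xb S σ)
    (hb : IsSignalled Xb σ b) {Y : Set Hex} (hY : occupied σ ⊆ Y) (hbY : b ∈ Y) :
    (assemblyGraph Y).Reachable (0, 0) b := by
  obtain ⟨x, m, w, hx, -, rfl⟩ := hb
  have hxo : x ∈ occupied σ := ⟨m, hx⟩
  exact ((hI.reachable x hxo).mono (assemblyGraph_mono hY)).trans
    (adj_add_dir (hY hxo) hbY).reachable

/-- The memory of a robot that docks next to the parent of its segment. -/
theorem Invariant.memory_of_step (hfin : S.Finite) (hS : HoleFreeShape S)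
    (hT : target Xb = S) (hI : Invariant Xb S σ) (hroot : (0, 0) ∈ S) (h : Step Xb σ τ)
    (hb : IsSignalled Xb σ b) {V : Set Hex} (hV : occupied σ ⊆ V) (hV' : V ⊆ occupied τ)
    {f : Flank} {u : Wall} (hu : u ∈ f.walls) (hs : b + dir u ∈ S)
    (hp : IsParent S (0, 0) (b + dir u) b) :
    nucleates Xb V b f = false ∧ (initMemory Xb V b).growth = -f.column := by
  obtain ⟨hbS, hbX⟩ := hb.mem hT
  have hne := fst_add_dir_ne hu b
  have hnuc : nucleates Xb V b f = false := by
    refine nucleates_eq_false hT fun w hw hwS => hV ?_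
    exact hI.parent_of_isSignalled hfin hS hT hroot hb hw hwS
      (hp.congr_left (mem_segment_of_flank hu hw hs hwS) hne)
  have huV : status Xb V b u = .occupied := (status_eq_occupied hT).2
    ⟨hs, hV (hI.parent_of_isSignalled hfin hS hT hroot hb hu hs hp)⟩
  -- An occupied cell on the opposite flank, even one docking in the same step, would be a child or
  -- a second parent. A child cell cannot be occupied or signalled while its parent neighbour `b` is
  -- empty, and a second parent contradicts uniqueness.
  have hother : ∀ (f' : Flank), ∀ v ∈ f'.walls, f'.column ≠ f.column →
      status Xb V b v ≠ .occupied := by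
    intro f' v hv hff hocc
    obtain ⟨hvS, hvV⟩ := (status_eq_occupied hT).1 hocc
    have hadj := adj_add_dir hbS hvS
    rcases isParent_or_isParent hadj (fst_add_dir_ne hv b).symm
      (hI.reachable_of_isSignalled hb hI.subset hbS) hroot with h1 | h1
    · obtain ⟨f'', hf''⟩ := exists_flank_opposite hv
      have e := add_dir_add_dir_opposite b v
      refine hbX ?_
      rw [← e]
      rw [← e] at hbS
      nth_rewrite 1 [← e] at h1
      rcases h.mem_or_isSignalled (hV' hvV) with ⟨m, hm⟩ | hsig
      · exact (hI.parent _ m hm f'' _ hf'' hbS h1).1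
      · exact hI.parent_of_isSignalled hfin hS hT hroot hsig hf'' hbS h1
    · have h2 := (hp.unique hfin hS h1 (mem_segment_self hbS) (adj_add_dir hbS hs) hadj hne
        (fst_add_dir_ne hv b)).1
      rw [fst_add_dir hv, fst_add_dir hu] at h2
      omega
  refine ⟨hnuc, ?_⟩
  simp only [initMemory, growthDirection]
  -- The rules test for growth to the right first, so only a parent on the right needs `hother`.
  cases f
  · rw [if_neg (by simp [hnuc]), if_pos]
    · rfl
    · rcases hu with rfl | rfl <;> simp [huV]
  · have h1 := hother .left 1 (by simp [Flank.walls]) (by simp [Flank.column])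
    have h2 := hother .left 2 (by simp [Flank.walls]) (by simp [Flank.column])
    rw [if_neg (by simp [hnuc]), if_neg (by simp [hnuc, h1, h2]), if_pos]
    · rfl
    · rcases hu with rfl | rfl <;> simp [huV]

/-- Two cells of a segment that is empty before the step and not after it are next to the same
nucleation site. -/
theorem Invariant.site_unique (hfin : S.Finite) (hS : HoleFreeShape S) (hT : target Xb = S)
    (hI : Invariant Xb S σ) {f : Flank} {w : Wall} (hx : x ∈ S) (hw : w ∈ f.walls)
    (hs : x + dir w ∈ S) (hsite : NucSite Xb S x f) (hp : IsParent S (0, 0) x (x + dir w))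
    (hb : IsSignalled Xb σ b) (hbseg : b ∈ segment S (x + dir w))
    (hempty : ∀ c ∈ occupied σ, c ∉ segment S b) : ∃ w' ∈ f.walls, b = x + dir w' := by
  obtain ⟨x', f', hx', hsite', hp', w', hw', rfl⟩ := hI.exists_site hT hb hempty
  have hx'S := hI.subset hx'
  have hbS := segment_subset hbseg
  have hne : x'.1 ≠ (x + dir w).1 := by
    rw [← hbseg.1]; exact (fst_add_dir_ne hw' x').symm
  have hseg := hp.unique hfin hS hp' hbseg (adj_add_dir hx hs).symm (adj_add_dir hx'S hbS).symm
    (fst_add_dir_ne hw x).symm hne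
  have hff : f' = f := by
    have h1 := hbseg.1
    rw [fst_add_dir hw', fst_add_dir hw, hseg.1] at h1
    cases f <;> cases f' <;> simp_all [Flank.column]
  subst hff
  exact ⟨w', hw', by rw [hsite.unique hT hsite' hseg hw hw' hs hbseg]⟩

theorem Invariant.step (hfin : S.Finite) (hS : HoleFreeShape S) (hT : target Xb = S)
    (hI : Invariant Xb S σ) (hroot : (0, 0) ∈ S) (h : Step Xb σ τ) : Invariant Xb S τ := by
  have hmono := h.occupied_subset
  have hsub : occupied τ ⊆ S := fun b hb =>
    (h.mem_or_isSignalled hb).elim (fun hb => hI.subset hb) fun hb => (hb.mem hT).1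
  refine ⟨hmono hI.root, hsub, ?_, ?_, ?_, ?_, ?_⟩
  · intro b hb
    rcases h.mem_or_isSignalled hb with hb' | hb'
    · exact (hI.reachable b hb').mono (assemblyGraph_mono hmono)
    · exact hI.reachable_of_isSignalled hb' hmono hb
  · intro x hx y hy hxy z hz h1 h2
    -- In a segment that was empty, all new cells face one flank of one site, so there are at most
    -- two and they are adjacent.
    by_cases hempty : ∀ c ∈ occupied σ, c ∉ segment S x
    · have hx' := (h.mem_or_isSignalled hx).resolve_left
        fun hx' => hempty x hx' (mem_segment_self (hsub hx))
      have hy' := (h.mem_or_isSignalled hy).resolve_left fun hy' => hempty y hy' hxy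
      obtain ⟨v, f, hv, hsite, hp, w, hw, rfl⟩ := hI.exists_site hT hx' hempty
      obtain ⟨w', hw', rfl⟩ := hI.site_unique hfin hS hT (hI.subset hv) hw (hsub hx) hsite hp hy'
        hxy (by rwa [segment_eq hxy])
      have hcases : z = v + dir w ∨ z = v + dir w' := by
        have hz' : z.1 = (v + dir w').1 := hz.trans hxy.1.symm
        have : z.2 = (v + dir w).2 ∨ z.2 = (v + dir w').2 := by
          cases f <;> rcases hw with rfl | rfl <;> rcases hw' with rfl | rfl <;>
            simp [dir] at h1 h2 ⊢ <;> omega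
        exact this.imp (Prod.ext hz) (Prod.ext hz')
      rcases hcases with rfl | rfl
      · exact hx
      · exact hy
    · push Not at hempty
      obtain ⟨c, hc, hcx⟩ := hempty
      -- In a segment already entered, every new cell is one row from an old one, so a cell strictly
      -- between two occupied cells lies between old ones.
      have near : ∀ v ∈ occupied τ, v ∈ segment S x → v ∉ occupied σ →
          ∃ v' ∈ occupied σ, v' ∈ segment S x ∧ (v'.2 = v.2 + 1 ∨ v'.2 = v.2 - 1) := by
        intro v hv hvx hvσ
        have hsig := (h.mem_or_isSignalled hv).resolve_left hvσ
        obtain ⟨v', hv', e1, e2⟩ := hI.exists_near hT hroot hsig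
          ⟨c, hc, by rwa [segment_eq hvx]⟩
        exact ⟨v', hv', mem_segment_trans hvx (mem_segment_of_near (hsub hv) (hI.subset hv') e1
          (by omega) (by omega)), e2⟩
      have near' : ∀ v ∈ occupied τ, v ∈ segment S x → ∃ v' ∈ occupied σ, v' ∈ segment S x ∧
          (v' = v ∨ v'.2 = v.2 + 1 ∨ v'.2 = v.2 - 1) := by
        intro v hv hvx
        by_cases hvσ : v ∈ occupied σ
        · exact ⟨v, hvσ, hvx, Or.inl rfl⟩
        · obtain ⟨v', h1, h2, h3⟩ := near v hv hvx hvσ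
          exact ⟨v', h1, h2, Or.inr h3⟩
      obtain ⟨x', hx', hx's, ex⟩ := near' x hx (mem_segment_self (hsub hx))
      obtain ⟨y', hy', hy's, ey⟩ := near' y hy hxy
      by_cases hzx : z.2 = x.2
      · rwa [show z = x from Prod.ext hz hzx]
      by_cases hzy : z.2 = y.2
      · rwa [show z = y from Prod.ext (hz.trans hxy.1.symm) hzy]
      refine hmono (hI.contiguous x' hx' y' hy' (by rwa [segment_eq hx's]) z (hz.trans hx's.1.symm)
        ?_ ?_) <;> rcases ex with rfl | ex <;> rcases ey with rfl | ey <;> omega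
  · intro b m hm f w hw hs hp
    cases hσ : σ b with
    | some m' =>
      have := h.1 b m' hσ
      rw [hm, Option.some_inj] at this
      subst this
      obtain ⟨h1, h2⟩ := hI.parent b m hσ f w hw hs hp
      exact ⟨hmono h1, h2⟩
    | none =>
      obtain ⟨hsig, V, hV, hV', rfl⟩ := h.2 b m hσ hm
      refine ⟨hmono (hI.parent_of_isSignalled hfin hS hT hroot hsig hw hs hp), ?_⟩
      rw [initMemory_nuc]
      exact hI.memory_of_step hfin hS hT hroot h hsig hV hV' hw hs hp
  · intro b m hm f hf
    cases hσ : σ b with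
    | some m' =>
      have := h.1 b m' hσ
      rw [hm, Option.some_inj] at this
      subst this
      exact hI.site b m hσ f hf
    | none =>
      obtain ⟨-, V, -, -, rfl⟩ := h.2 b m hσ hm
      rw [initMemory_nuc] at hf
      exact nucSite_of_nucleates hT hf
  · rintro x hx f w hw hs hsite hp ⟨c, hc, hcs⟩
    by_cases hempty : ∀ c ∈ occupied σ, c ∉ segment S (x + dir w)
    · have hc' := (h.mem_or_isSignalled hc).resolve_left fun hc' => hempty c hc' hcs
      obtain ⟨w', hw', rfl⟩ := hI.site_unique hfin hS hT hx hw hs hsite hp hc' hcs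
        (by rwa [segment_eq hcs])
      exact ⟨w', hw', hc⟩
    · push Not at hempty
      obtain ⟨w', hw', h'⟩ := hI.nucleated x hx f w hw hs hsite hp hempty
      exact ⟨w', hw', hmono h'⟩

end Step

/-! ### Contiguous segments exclude holes -/

/-- If the parity of the crossings of a walk differs between two positions of a column, then the
walk visits a cell of the column between them. -/
theorem exists_mem_support_between {G : SimpleGraph Hex} {u v : Hex} (c : G.Walk u v) {y z : Hex}
    (hyz : z.1 = y.1) (hle : y.2 ≤ z.2)
    (hne : walkWeight (crossing y) c ≠ walkWeight (crossing z) c) :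
    ∃ a ∈ c.support, a.1 = y.1 ∧ y.2 < a.2 ∧ a.2 ≤ z.2 := by
  by_contra! hcon
  refine hne (congrArg List.sum (List.map_congr_left fun d hd => ?_))
  have h1 := hcon _ (c.dart_fst_mem_support_of_mem_darts hd)
  have h2 := hcon _ (c.dart_snd_mem_support_of_mem_darts hd)
  rw [crossing_eq, crossing_eq]
  exact if_congr (by omega) rfl rfl

/-- The crossing parity is odd at the enclosed cell `y` and even just beyond both ends of its
segment, because `S` is hole-free. Each change of parity forces the cycle to visit the segment on
that side of `y`. -/
theorem holeFreeAssembly_of_contiguous {S X : Set Hex} (hfin : S.Finite) (hS : HoleFreeShape S)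
    (hX : X ⊆ S) (hcont : ∀ x ∈ X, ∀ y ∈ X, y ∈ segment S x → ∀ z : Hex, z.1 = x.1 →
      min x.2 y.2 ≤ z.2 → z.2 ≤ max x.2 y.2 → z ∈ X) : HoleFreeAssembly S X := by
  rintro v c hc y ⟨hyS, hyX⟩ ⟨-, hodd⟩
  rw [odd_countP_iff] at hodd
  have hv : v ∈ X := by
    cases c with
    | nil => exact absurd rfl hc.ne_nil
    | cons e p => exact e.1
  have heven : ∀ z ∉ S, walkWeight (crossing z) c = 0 := by
    intro z hz
    obtain ⟨φ, hφ⟩ := hS.exists_potential hz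
    rw [walkWeight_eq_potential fun a b hab => hφ a b (assemblyGraph_mono hX hab)]
    exact CharTwo.add_self_eq_zero _
  obtain ⟨l, u, hl, hu, hseg⟩ := exists_segment_bounds hfin hyS
  have hy := (hseg y).1 (mem_segment_self hyS)
  obtain ⟨a, ha, ha1, ha2, ha3⟩ := exists_mem_support_between c (y := y) (z := (y.1, u + 1)) rfl
    (by simp only; omega) (by rw [hodd, heven _ hu]; decide)
  obtain ⟨b, hb, hb1, hb2, hb3⟩ := exists_mem_support_between c (y := (y.1, l - 1)) (z := y) rfl
    (by simp only; omega) (by rw [hodd, heven _ hl]; decide)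
  have haX := mem_of_mem_support c hv ha
  have hbX := mem_of_mem_support c hv hb
  simp only at ha3 hb1 hb2
  -- The crossing argument allows the upper endpoint itself, which is outside `S`.
  have ha4 : a.2 ≠ u + 1 := fun h => hu (by rw [← h, ← ha1]; exact hX haX)
  have has := (hseg a).2 ⟨ha1, by omega, by omega⟩
  have hbs := (hseg b).2 ⟨hb1, by omega, by omega⟩
  exact hyX (hcont b hbX a haX (by rwa [segment_eq hbs]) y hb1.symm (by omega) (by omega))

theorem Invariant.of_isExecution {S : Set Hex} (hfin : S.Finite) (hroot : (0, 0) ∈ S)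
    (hS : HoleFreeShape S) {σ : ℕ → State} (hσ : IsExecution (perimeter S) σ) (t : ℕ) :
    Invariant (perimeter S) S (σ t) := by
  have hT := target_perimeter hfin hS
  induction t with
  | zero => exact Invariant.of_isInitial hT hroot hσ.1
  | succ t ih => exact ih.step hfin hS hT hroot (hσ.2 t)

end Huddle

theorem theorem2 (S : Set Huddle.Hex) (hfin : S.Finite) (hroot : (0, 0) ∈ S)
    (hS : Huddle.HoleFreeShape S)
    (σ : ℕ → Huddle.State) (hσ : Huddle.IsExecution (Huddle.perimeter S) σ) (t : ℕ) :
    Huddle.HoleFreeAssembly S (Huddle.occupied (σ t)) := by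
  have h := Huddle.Invariant.of_isExecution hfin hroot hS hσ t
  exact Huddle.holeFreeAssembly_of_contiguous hfin hS h.subset h.contiguous
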